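/- For a Lebesgue measurable set $\Omega\subset\mathbb R$ with finite positive measure $|\Omega|$, say that $\Omega$ tiles $\mathbb R$ by translations if there is a set $\mathcal T\subset\mathbb R$ such that the translates $\Omega+t$, $t\in\mathcal T$, form a partition of $\mathbb R$ up to Lebesgue null sets: $|(\Omega+s)\cap(\Omega+t)|=0$ for distinct $s,t\in\mathcal T$, and $|\mathbb R\setminus\bigcup_{t\in\mathcal T}(\Omega+t)|=0$. Say that $\Omega$ is a spectral set if there is a set $\Lambda\subset\mathbb R$ such that the functions $e_\lambda(x)=|\Omega|^{-1/2}e^{2\pi i\lambda x}\chi_\Omega(x)$, $\lambda\in\Lambda$, form an orthonormal basis of $L^2(\Omega)$. Theorem 2.1. Let $A,B,C\subset\mathbb R$ be three pairwise disjoint intervals of positive length with $|A|+|B|+|C|=1$, and let $\Omega=A\cup B\cup C$. If $\Omega$ tiles $\mathbb R$ by translations, then $\Omega$ is a spectral set. -/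

import Mathlib

open MeasureTheory

/-- `T` is a tiling set for `Ω` (a measurable set of finite positive measure): the translates
`Ω + t`, `t ∈ T`, form a partition of `ℝ` up to Lebesgue null sets. -/
def IsTilingPair (Ω T : Set ℝ) : Prop :=
  (T.Pairwise fun s t => volume (((fun x => x + s) '' Ω) ∩ ((fun x => x + t) '' Ω)) = 0) ∧
    volume (⋃ t ∈ T, (fun x => x + t) '' Ω)ᶜ = 0

/-- `Ω` tiles `ℝ` by translations. -/
def TilesByTranslations (Ω : Set ℝ) : Prop :=
  ∃ T : Set ℝ, IsTilingPair Ω T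

/-- The function `e_lam(x) = |Ω|^(-1/2) * exp(2 π i lam x) * χ_Ω(x)`. -/
noncomputable def expFun (Ω : Set ℝ) (lam : ℝ) : ℝ → ℂ :=
  Ω.indicator fun x =>
    ((1 / √(volume.real Ω) : ℝ) : ℂ) * Complex.exp (2 * Real.pi * Complex.I * lam * x)

/-- `(Ω, Λ)` is a spectral pair (`Ω` a measurable set of finite positive measure): the functions
`e_lam`, `lam ∈ Λ`, form an orthonormal basis of the Hilbert space `L²(Ω)`. -/
def IsSpectralPair (Ω Λ : Set ℝ) : Prop :=
  ∃ b : HilbertBasis Λ ℂ (Lp ℂ 2 (volume.restrict Ω)),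
    ∀ lam : Λ, (b lam : ℝ → ℂ) =ᵐ[volume.restrict Ω] expFun Ω lam

/-- `Ω` is a spectral set. -/
def IsSpectralSet (Ω : Set ℝ) : Prop :=
  ∃ Λ : Set ℝ, IsSpectralPair Ω Λ

/-!
Write the tiling as a word, infinite in both directions, in three letters of lengths `ℓ 0`, `ℓ 1`,
`ℓ 2` (`IsIntervalTiling`). A translate carries one copy of each letter, so the distances between
consecutive copies of one letter are the same for all three letters. This decides which words occur.

* If no letter is repeated and the lengths are not all equal, a letter whose length differs from
  the others returns after distance one or less, and by density after distance one eventually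
  (`gap_of_no_repeat`, `exists_add_nat_mem`). Hence the set packs, and so tiles, with `ℤ`, and `ℤ`
  is a spectrum.
* If a letter is repeated, the lengths are all equal or this letter has length `1 / 2`
  (`length_eq_of_repeat`).
* For three equal lengths the tiling is one of `ℤ` by three elements `{0, P, Q}`; dividing by the
  gcd, these represent all classes modulo three (`exists_not_three_dvd_of_tiling`).
* For lengths `1 / 2`, `b`, `c`, the short intervals together form a second layer over the long one
  modulo `1 / 2`. If `b ≠ c`, this follows from the word between blocks of the long letter: it
  alternates between the short letters, its two kinds of letters stem from two blocks whose indices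
  are shifted by constants, and the resulting recurrence forces it to be a power of one pair of
  short letters (`run_recurrence_rigid`). If `b = c = 1 / 4`, it follows from the cyclotomic factors
  of a four-element set that tiles `ℤ` (`exists_odd_of_quadruple_tiling`).

In every case the points of the set in one class modulo `1 / n`, with `n` equal to `1`, `2` or `3`,
are separated by `n`-th roots of unity under some exponential `exp (2 π i θ x)`. Folding to the
circle of length `1 / n` and Parseval's identity there show that the exponentials with frequencies
`n k + l θ`, `0 ≤ l < n`, form an orthonormal basis (`isSpectralSet_of_fold`).
-/

/-! ### Parseval families and folding -/

/-- Unit vectors satisfying Parseval's identity are orthonormal: the identity for `v j` already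
exhausts `‖v j‖ ^ 2 = 1` with the term `i = j`. -/
theorem orthonormal_of_parseval {ι H : Type*} [NormedAddCommGroup H] [InnerProductSpace ℂ H]
    {v : ι → H} (h1 : ∀ i, ‖v i‖ = 1)
    (hp : ∀ f, HasSum (fun i => ‖inner ℂ (v i) f‖ ^ 2) (‖f‖ ^ 2)) : Orthonormal ℂ v := by
  refine ⟨h1, fun i j hij => ?_⟩
  classical
  have hs := hp (v j)
  have hle := sum_le_hasSum (s := {i, j}) (fun k _ => by positivity) hs
  rw [Finset.sum_pair hij, h1 j, inner_self_eq_norm_sq_to_K, h1 j] at hle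
  have : ‖inner ℂ (v i) (v j)‖ ^ 2 ≤ 0 := by simpa using hle
  simpa using this

theorem orthogonal_span_eq_bot_of_parseval {ι H : Type*} [NormedAddCommGroup H]
    [InnerProductSpace ℂ H] {v : ι → H}
    (hp : ∀ f, HasSum (fun i => ‖inner ℂ (v i) f‖ ^ 2) (‖f‖ ^ 2)) :
    (Submodule.span ℂ (Set.range v))ᗮ = ⊥ := by
  rw [Submodule.eq_bot_iff]
  intro f hf
  rw [Submodule.mem_orthogonal] at hf
  have h0 : ∀ i, inner ℂ (v i) f = 0 := fun i => hf _ (Submodule.subset_span ⟨i, rfl⟩)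
  have h := hp f
  simp only [h0, norm_zero, ne_eq, OfNat.ofNat_ne_zero, not_false_eq_true, zero_pow] at h
  have := h.unique hasSum_zero
  simpa using this

theorem integral_eq_sum_translates {E : Type*} [NormedAddCommGroup E] [NormedSpace ℝ E]
    {φ : ℝ → E} (hφ : Integrable φ) {T : ℝ} (hT : 0 < T) (K : ℕ)
    (hs : ∀ x, x ∉ Set.Ioc (-(K * T)) (K * T) → φ x = 0) :
    ∫ x, φ x = ∑ j ∈ Finset.range (2 * K), ∫ x in (0 : ℝ)..T, φ (x + (j - K) * T) := by
  have h1 : ∫ x, φ x = ∫ x in (-(K * T))..(K * T), φ x := by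
    rw [intervalIntegral.integral_of_le (by nlinarith [K.cast_nonneg (α := ℝ)]),
      setIntegral_eq_integral_of_forall_compl_eq_zero hs]
  have h2 := intervalIntegral.sum_integral_adjacent_intervals (μ := volume) (f := φ)
    (a := fun j : ℕ => ((j : ℝ) - K) * T) (n := 2 * K) (fun k _ => hφ.intervalIntegrable)
  rw [h1]
  convert h2.symm using 1
  · congr 1 <;> push_cast <;> ring
  · refine Finset.sum_congr rfl fun j _ => ?_
    rw [intervalIntegral.integral_comp_add_right]
    congr 1 <;> push_cast <;> ring

/-- Parseval on the circle of length `T`, for the periodization of a function supported in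
`(-KT, KT]`: the Fourier integrals of `h` at the frequencies `k / T` are `T` times the Fourier
coefficients of the folded function. -/
theorem hasSum_sq_fourierIntegral_of_fold {h : ℝ → ℂ} (hL1 : Integrable h) (hL2 : MemLp h 2)
    {T : ℝ} (hT : 0 < T) (K : ℕ) (hs : ∀ x, x ∉ Set.Ioc (-(K * T)) (K * T) → h x = 0) :
    HasSum (fun k : ℤ => ‖∫ x : ℝ, Complex.exp (-(2 * Real.pi * Complex.I * (k / T : ℝ) * x)) * h x‖ ^ 2)
      (T * ∫ x in (0 : ℝ)..T, ‖∑ j ∈ Finset.range (2 * K), h (x + (j - K) * T)‖ ^ 2) := by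
  set F : ℝ → ℂ := fun x => ∑ j ∈ Finset.range (2 * K), h (x + (j - K) * T) with hF
  have hmp : ∀ c : ℝ, MeasurePreserving (fun x : ℝ => x + c) volume volume :=
    fun c => measurePreserving_add_right volume c
  have hFL2 : MemLp F 2 volume := by
    refine memLp_finsetSum _ fun j _ => ?_
    exact hL2.comp_measurePreserving (hmp _)
  have key := hasSum_sq_fourierCoeffOn hT (hFL2.restrict (Set.Ioc 0 T))
  have hcoef : ∀ k : ℤ, ∫ x : ℝ, Complex.exp (-(2 * Real.pi * Complex.I * (k / T : ℝ) * x)) * h x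
      = T * fourierCoeffOn hT F k := by
    intro k
    have hint : Integrable
        (fun x : ℝ => Complex.exp (-(2 * Real.pi * Complex.I * (k / T : ℝ) * x)) * h x) := by
      refine hL1.bdd_mul (c := 1) (by fun_prop) (Filter.Eventually.of_forall fun x => ?_)
      rw [Complex.norm_exp]
      simp
    rw [integral_eq_sum_translates hint hT K (fun x hx => by rw [hs x hx, mul_zero]),
      fourierCoeffOn_eq_integral, ← intervalIntegral.integral_finsetSum]
    · have hTc : (T : ℂ) ≠ 0 := by exact_mod_cast hT.ne'
      rw [sub_zero, Complex.real_smul]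
      push_cast
      rw [← mul_assoc, mul_one_div_cancel hTc, one_mul]
      refine intervalIntegral.integral_congr fun x _ => ?_
      simp only [hF, smul_eq_mul, Finset.mul_sum]
      refine Finset.sum_congr rfl fun j _ => ?_
      congr 1
      rw [fourier_coe_apply]
      rw [Complex.exp_eq_exp_iff_exists_int]
      refine ⟨-(k * ((j : ℤ) - K)), ?_⟩
      push_cast
      field_simp
      ring
    · intro j _
      exact (hint.comp_add_right _).intervalIntegrable
  have h2 := key.mul_left (T ^ 2)
  have e2 : T ^ 2 * ((T - 0)⁻¹ • ∫ x in (0 : ℝ)..T, ‖F x‖ ^ 2) = T * ∫ x in (0 : ℝ)..T, ‖F x‖ ^ 2 := by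
    rw [sub_zero, smul_eq_mul]
    field_simp
  rw [e2] at h2
  convert! h2 using 2 with k
  rw [hcoef, norm_mul, mul_pow]
  simp

/-- A finite Parseval identity: if the quotients of the unimodular numbers `u i`, over the
support of `g`, are nontrivial `n`-th roots of unity, the cross terms are full geometric sums
and vanish. -/
theorem sum_sq_norm_sum_mul_pow {ι : Type*} (s : Finset ι) (n : ℕ) (g u : ι → ℂ)
    (hu : ∀ i, ‖u i‖ = 1)
    (h : ∀ i ∈ s, ∀ j ∈ s, i ≠ j → g i ≠ 0 → g j ≠ 0 →
      (u i * star (u j)) ^ n = 1 ∧ u i * star (u j) ≠ 1) :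
    ∑ l ∈ Finset.range n, ‖∑ i ∈ s, g i * u i ^ l‖ ^ 2 = n * ∑ i ∈ s, ‖g i‖ ^ 2 := by
  have hc : ∀ z : ℂ, ((‖z‖ ^ 2 : ℝ) : ℂ) = z * star z := fun z => by
    rw [Complex.star_def, Complex.mul_conj, Complex.normSq_eq_norm_sq]
  apply Complex.ofReal_injective
  push_cast
  have hc' : ∀ z : ℂ, ((‖z‖ : ℂ)) ^ 2 = z * star z := fun z => by rw [← hc]; push_cast; rfl
  simp only [hc', star_sum, Finset.sum_mul_sum]
  rw [Finset.sum_comm, Finset.mul_sum]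
  refine Finset.sum_congr rfl fun i hi => ?_
  rw [Finset.sum_comm, Finset.sum_eq_single_of_mem i hi]
  · have : ∀ l, g i * u i ^ l * star (g i * u i ^ l) = g i * star (g i) := by
      intro l
      have h2 : u i * star (u i) = 1 := by rw [← hc, hu]; simp
      calc g i * u i ^ l * star (g i * u i ^ l)
          = g i * star (g i) * (u i * star (u i)) ^ l := by
            rw [star_mul, star_pow, mul_pow]; ring
        _ = _ := by rw [h2, one_pow, mul_one]
    rw [Finset.sum_congr rfl fun l _ => this l, Finset.sum_const, Finset.card_range, nsmul_eq_mul]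
  · intro j hj hji
    have : ∀ l, g i * u i ^ l * star (g j * u j ^ l)
        = g i * star (g j) * (u i * star (u j)) ^ l := fun l => by
      rw [star_mul, star_pow, mul_pow]; ring
    simp only [this, ← Finset.mul_sum]
    by_cases hgi : g i = 0
    · simp [hgi]
    by_cases hgj : g j = 0
    · simp [hgj]
    obtain ⟨h1, h2⟩ := h i hi j hj hji.symm hgi hgj
    rw [geom_sum_eq h2, h1, sub_self, zero_div, mul_zero]

/-! ### A criterion for spectral sets -/

theorem memLp_expFun {Ω : Set ℝ} (hm : MeasurableSet Ω) (hfin : volume Ω ≠ ⊤) (lam : ℝ) :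
    MemLp (expFun Ω lam) 2 (volume.restrict Ω) := by
  have : IsFiniteMeasure (volume.restrict Ω) := ⟨by simpa using hfin.lt_top⟩
  refine MemLp.of_bound (C := 1 / √(volume.real Ω)) ?_ (Filter.Eventually.of_forall fun x => ?_)
  · exact (Measurable.indicator (by fun_prop) hm).aestronglyMeasurable
  · refine (norm_indicator_le_norm_self _ _).trans ?_
    rw [norm_mul, Complex.norm_exp, Complex.norm_real]
    simp [abs_of_nonneg (Real.sqrt_nonneg _)]

theorem inner_toLp_expFun {Ω : Set ℝ} (hm : MeasurableSet Ω) (hv : volume Ω = 1) (lam : ℝ)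
    (f : Lp ℂ 2 (volume.restrict Ω)) :
    inner ℂ ((memLp_expFun hm (by simp [hv]) lam).toLp) f
      = ∫ x : ℝ, Complex.exp (-(2 * Real.pi * Complex.I * lam * x)) * Ω.indicator f x := by
  have hreal : volume.real Ω = 1 := by simp [measureReal_def, hv]
  rw [L2.inner_def]
  have h1 : ∀ x : ℝ, Complex.exp (-(2 * Real.pi * Complex.I * lam * x)) * Ω.indicator f x
      = Ω.indicator (fun x : ℝ => Complex.exp (-(2 * Real.pi * Complex.I * lam * x)) * f x) x := by
    intro x
    by_cases hx : x ∈ Ω <;> simp [hx]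
  simp_rw [h1]
  rw [integral_indicator hm]
  refine integral_congr_ae ?_
  filter_upwards [(memLp_expFun hm (by simp [hv]) lam).coeFn_toLp, ae_restrict_mem hm] with x hx hxm
  rw [hx, RCLike.inner_apply, expFun, Set.indicator_of_mem hxm, hreal, mul_comm]
  congr 1
  simp [← Complex.exp_conj, Complex.conj_ofNat]

/-- Criterion for a spectrum of the form `n ℤ + {0, θ, ..., (n - 1) θ}`. The hypothesis asks that
the values `exp (2 π i θ x)` at the points `x` of `Ω` in one class modulo `1 / n` differ from each
other by nontrivial `n`-th roots of unity. Folding `Ω` onto `ℝ / (1 / n) ℤ` turns this into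
Parseval's identity for the exponentials, and as `|Ω| = 1` these are unit vectors, so no separate
proof of orthogonality is needed. -/
theorem isSpectralSet_of_fold {Ω : Set ℝ} (hm : MeasurableSet Ω) (hb : Bornology.IsBounded Ω)
    (hv : volume Ω = 1) {n : ℕ} (hn : 0 < n) (θ : ℝ)
    (h : ∀ x ∈ Ω, ∀ y ∈ Ω, x ≠ y → ∀ k : ℤ, x - y = k / n →
      (∃ m : ℤ, n * (θ * (x - y)) = m) ∧ ∀ m : ℤ, θ * (x - y) ≠ m) :
    IsSpectralSet Ω := by
  have hn0 : (0 : ℝ) < n := by exact_mod_cast hn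
  set T : ℝ := 1 / n with hTdef
  have hT : 0 < T := by positivity
  obtain ⟨K, hK⟩ : ∃ K : ℕ, Ω ⊆ Set.Ioc (-(K * T)) (K * T) := by
    obtain ⟨R, hR⟩ := hb.exists_norm_le
    obtain ⟨K, hK⟩ := exists_nat_gt (R / T)
    rw [div_lt_iff₀ hT] at hK
    refine ⟨K, fun x hx => ?_⟩
    have := abs_le.1 (hR x hx)
    exact ⟨by linarith, by linarith⟩
  set lam : Fin n × ℤ → ℝ := fun i => i.2 / T + i.1 * θ with hlam
  set w : Fin n × ℤ → Lp ℂ 2 (volume.restrict Ω) :=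
    fun i => (memLp_expFun hm (by simp [hv]) (lam i)).toLp with hw
  have hreal : volume.real Ω = 1 := by simp [measureReal_def, hv]
  have : IsFiniteMeasure (volume.restrict Ω) := ⟨by simp [hv]⟩
  have hparseval : ∀ f, HasSum (fun i => ‖inner ℂ (w i) f‖ ^ 2) (‖f‖ ^ 2) := by
    intro f
    set g : ℝ → ℂ := Ω.indicator f with hg
    set u : ℝ → ℂ := fun x => Complex.exp (-(2 * Real.pi * Complex.I * θ * x)) with hu
    have hunorm : ∀ x, ‖u x‖ = 1 := fun x => by simp [hu, Complex.norm_exp]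
    have hgs : ∀ x, x ∉ Set.Ioc (-(K * T)) (K * T) → g x = 0 := fun x hx =>
      Set.indicator_of_notMem (fun hx' => hx (hK hx')) _
    have hgL2 : MemLp g 2 volume := (memLp_indicator_iff_restrict hm).2 (Lp.memLp f)
    have hgL1 : Integrable g volume := (integrable_indicator_iff hm).2
      ((Lp.memLp f).integrable (by norm_num))
    have hgsq : Integrable (fun x => ‖g x‖ ^ 2) := hgL2.integrable_norm_pow (by norm_num)
    have hhL1 : ∀ l : ℕ, Integrable (fun x => g x * u x ^ l) := fun l =>
      hgL1.mul_bdd (c := 1) (by fun_prop) (Filter.Eventually.of_forall fun x => by simp [hunorm])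
    have hhL2 : ∀ l : ℕ, MemLp (fun x => g x * u x ^ l) 2 := fun l => by
      refine (memLp_congr_norm ?_ ?_ (Filter.Eventually.of_forall fun x => ?_)).1 hgL2
      · exact hgL2.aestronglyMeasurable
      · exact (hhL1 l).aestronglyMeasurable
      · simp [hunorm]
    have hrow : ∀ l : Fin n, HasSum (fun k : ℤ => ‖inner ℂ (w (l, k)) f‖ ^ 2)
        (T * ∫ x in (0 : ℝ)..T, ‖∑ j ∈ Finset.range (2 * K),
          g (x + (j - K) * T) * u (x + (j - K) * T) ^ (l : ℕ)‖ ^ 2) := by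
      intro l
      convert! hasSum_sq_fourierIntegral_of_fold (hhL1 l) (hhL2 l) hT K
        (fun x hx => by simp only [hgs x hx, zero_mul]) using 2 with k
      rw [hw, inner_toLp_expFun hm hv]
      congr 2
      refine integral_congr_ae (Filter.Eventually.of_forall fun x => ?_)
      simp only [hlam, hu, ← Complex.exp_nat_mul]
      rw [mul_comm (g x), ← mul_assoc, ← Complex.exp_add]
      congr 2
      push_cast
      ring
    have hIcont : ∀ l : ℕ, IntervalIntegrable (fun x => ‖∑ j ∈ Finset.range (2 * K),
          g (x + (j - K) * T) * u (x + (j - K) * T) ^ l‖ ^ 2) volume 0 T := by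
      intro l
      refine Integrable.intervalIntegrable (MemLp.integrable_norm_pow (p := 2) ?_ (by norm_num))
      refine memLp_finsetSum _ fun j _ => ?_
      exact (hhL2 l).comp_measurePreserving (measurePreserving_add_right volume ((j - K) * T))
    have htotal : ∑ l : Fin n, (T * ∫ x in (0 : ℝ)..T, ‖∑ j ∈ Finset.range (2 * K),
          g (x + (j - K) * T) * u (x + (j - K) * T) ^ (l : ℕ)‖ ^ 2) = ‖f‖ ^ 2 := by
      rw [Fin.sum_univ_eq_sum_range (fun l => T * ∫ x in (0 : ℝ)..T, ‖∑ j ∈ Finset.range (2 * K),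
          g (x + (j - K) * T) * u (x + (j - K) * T) ^ l‖ ^ 2) n, ← Finset.mul_sum,
        ← intervalIntegral.integral_finsetSum fun l _ => hIcont l]
      have hpt : ∀ x : ℝ, ∑ l ∈ Finset.range n, ‖∑ j ∈ Finset.range (2 * K),
          g (x + (j - K) * T) * u (x + (j - K) * T) ^ l‖ ^ 2
          = n * ∑ j ∈ Finset.range (2 * K), ‖g (x + (j - K) * T)‖ ^ 2 := by
        intro x
        refine sum_sq_norm_sum_mul_pow (Finset.range (2 * K)) n
          (fun j : ℕ => g (x + (j - K) * T)) (fun j : ℕ => u (x + (j - K) * T))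
          (fun j => hunorm _) ?_
        intro i _ j _ hij hgi hgj
        have hi : x + (i - K) * T ∈ Ω := by
          by_contra hcon; exact hgi (Set.indicator_of_notMem hcon _)
        have hj : x + (j - K) * T ∈ Ω := by
          by_contra hcon; exact hgj (Set.indicator_of_notMem hcon _)
        have hdiff : (x + (i - K) * T) - (x + (j - K) * T) = (((i : ℤ) - j : ℤ) : ℝ) / n := by
          rw [hTdef]; push_cast; field_simp; ring
        have hne : x + (i - K) * T ≠ x + (j - K) * T := by
          intro hcon
          rw [hcon, sub_self, eq_comm, div_eq_zero_iff] at hdiff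
          rcases hdiff with hd | hd
          · exact hij (by exact_mod_cast sub_eq_zero.1 (by exact_mod_cast hd : (i : ℤ) - j = 0))
          · exact hn0.ne' hd
        obtain ⟨⟨m, hm1⟩, hm2⟩ := h _ hi _ hj hne _ hdiff
        set δ := (x + (i - K) * T) - (x + (j - K) * T) with hδ
        have huu : u (x + (i - K) * T) * star (u (x + (j - K) * T))
            = Complex.exp (-(2 * Real.pi * Complex.I * (θ * δ : ℝ))) := by
          simp only [hu, Complex.star_def, ← Complex.exp_conj, ← Complex.exp_add]
          congr 1
          simp [hδ, Complex.conj_ofNat]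
          ring
        simp only [huu]
        constructor
        · rw [← Complex.exp_nat_mul, Complex.exp_eq_one_iff]
          refine ⟨-m, ?_⟩
          have : ((n : ℂ)) * ((θ * δ : ℝ) : ℂ) = m := by exact_mod_cast hm1
          push_cast at this ⊢
          linear_combination (-(2 * Real.pi * Complex.I)) * this
        · rw [Ne, Complex.exp_eq_one_iff]
          rintro ⟨m', hm'⟩
          refine hm2 (-m') ?_
          have h2 : (2 * Real.pi * Complex.I) * (((θ * δ : ℝ) : ℂ) + m') = 0 := by
            linear_combination -hm'
          have h3 := (mul_eq_zero.1 h2).resolve_left Complex.two_pi_I_ne_zero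
          have h4 : θ * δ + m' = 0 := by exact_mod_cast h3
          push_cast; linarith
      simp only [hpt]
      rw [intervalIntegral.integral_const_mul, ← mul_assoc, hTdef, one_div_mul_cancel hn0.ne',
        one_mul, ← hTdef, intervalIntegral.integral_finsetSum
          (fun j _ => (hgsq.comp_add_right _).intervalIntegrable),
        ← integral_eq_sum_translates hgsq hT K (fun x hx => by rw [hgs x hx]; simp)]
      have hnorm : ((‖f‖ ^ 2 : ℝ) : ℂ) = ((∫ x, ‖g x‖ ^ 2 : ℝ) : ℂ) := by
        have h1 := inner_self_eq_norm_sq_to_K (𝕜 := ℂ) f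
        rw [L2.inner_def] at h1
        push_cast
        refine h1.symm.trans ?_
        rw [← integral_complex_ofReal]
        have h2 : ∀ x : ℝ, ((‖g x‖ ^ 2 : ℝ) : ℂ)
            = Ω.indicator (fun x => ((‖f x‖ ^ 2 : ℝ) : ℂ)) x := by
          intro x
          by_cases hx : x ∈ Ω <;> simp [hg, hx]
        simp_rw [h2]
        rw [integral_indicator hm]
        refine integral_congr_ae (Filter.Eventually.of_forall fun x => ?_)
        simp
      exact (Complex.ofReal_injective hnorm).symm
    have hsum : Summable fun i => ‖inner ℂ (w i) f‖ ^ 2 := by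
      rw [summable_prod_of_nonneg (fun i => by positivity)]
      exact ⟨fun l => (hrow l).summable, Summable.of_finite⟩
    have := hsum.hasSum
    rw [hsum.tsum_prod' fun l => (hrow l).summable, tsum_fintype,
      Finset.sum_congr rfl fun l _ => (hrow l).tsum_eq, htotal] at this
    exact this
  have hnorm : ∀ i, ‖w i‖ = 1 := by
    intro i
    have h1 := inner_self_eq_norm_sq_to_K (𝕜 := ℂ) (w i)
    simp only [hw] at h1 ⊢
    rw [inner_toLp_expFun hm hv] at h1
    have h2 : ∫ x : ℝ, Complex.exp (-(2 * Real.pi * Complex.I * lam i * x)) *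
        Ω.indicator ((memLp_expFun hm (by simp [hv]) (lam i)).toLp) x = 1 := by
      have h3 : (fun x : ℝ => Complex.exp (-(2 * Real.pi * Complex.I * lam i * x)) *
        Ω.indicator ((memLp_expFun hm (by simp [hv]) (lam i)).toLp) x)
          = Ω.indicator (fun x : ℝ => Complex.exp (-(2 * Real.pi * Complex.I * lam i * x)) *
             ((memLp_expFun hm (by simp [hv]) (lam i)).toLp : ℝ → ℂ) x) := by
        ext x; by_cases hx : x ∈ Ω <;> simp [hx]
      rw [h3, integral_indicator hm]
      have h4 : ∫ x in Ω, (1 : ℂ) = 1 := by simp [hreal]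
      rw [← h4]
      refine integral_congr_ae ?_
      filter_upwards [(memLp_expFun hm (by simp [hv]) (lam i)).coeFn_toLp, ae_restrict_mem hm]
        with x hx hxm
      rw [hx, expFun, Set.indicator_of_mem hxm, hreal]
      simp [← Complex.exp_add]
    rw [h2] at h1
    have h5 : ‖(memLp_expFun hm (by simp [hv]) (lam i)).toLp‖ ^ 2 = (1 : ℝ) := by
      apply Complex.ofReal_injective
      push_cast
      exact h1.symm
    exact (pow_eq_one_iff_of_nonneg (norm_nonneg _) two_ne_zero).1 h5
  have hort := orthonormal_of_parseval hnorm hparseval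
  have hinj : Function.Injective lam := by
    intro i j hij
    refine hort.linearIndependent.injective ?_
    simp only [hw, hij]
  set e := Equiv.ofInjective lam hinj with he
  have hort' : Orthonormal ℂ (w ∘ e.symm) := hort.comp _ e.symm.injective
  have hbot : (Submodule.span ℂ (Set.range (w ∘ e.symm)))ᗮ = ⊥ := by
    rw [e.symm.surjective.range_comp]
    exact orthogonal_span_eq_bot_of_parseval hparseval
  refine ⟨Set.range lam, HilbertBasis.mkOfOrthogonalEqBot hort' hbot, fun μ => ?_⟩
  rw [HilbertBasis.coe_mkOfOrthogonalEqBot]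
  have hμ : lam (e.symm μ) = μ := by
    conv_rhs => rw [← e.apply_symm_apply μ]
    rfl
  have := (memLp_expFun hm (by simp [hv]) (lam (e.symm μ))).coeFn_toLp
  rw [hμ] at this
  convert this using 2
  simp only [hw, Function.comp_apply, hμ]

theorem IsSpectralSet.congr_ae {Ω Ω' : Set ℝ} (h : Ω =ᵐ[volume] Ω') (hs : IsSpectralSet Ω') :
    IsSpectralSet Ω := by
  obtain ⟨Λ, b, hb⟩ := hs
  have hr : volume.restrict Ω = volume.restrict Ω' := Measure.restrict_congr_set h
  unfold IsSpectralSet IsSpectralPair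
  rw [hr]
  refine ⟨Λ, b, fun lam => (hb lam).trans ?_⟩
  have hvol : volume.real Ω = volume.real Ω' := measureReal_congr h
  refine ae_restrict_of_ae ?_
  filter_upwards [h] with x hx
  have hx' : x ∈ Ω ↔ x ∈ Ω' := iff_of_eq hx
  simp only [expFun, hvol]
  by_cases hxm : x ∈ Ω'
  · rw [Set.indicator_of_mem hxm, Set.indicator_of_mem (hx'.2 hxm)]
  · rw [Set.indicator_of_notMem hxm, Set.indicator_of_notMem (fun hc => hxm (hx'.1 hc))]

/-! ### Reduction to exact tilings by half-open intervals -/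

/-- The union of the three half-open intervals `[o i, o i + ℓ i)`. -/
def intervalUnion (o ℓ : Fin 3 → ℝ) : Set ℝ := ⋃ i, Set.Ico (o i) (o i + ℓ i)

/-- The translates by `T` of the intervals `[o i, o i + ℓ i)`, `i : Fin 3`, partition `ℝ` exactly.
The index `i` is the letter of a translate, and `x - o i ∈ T` says that a translate with letter `i`
starts at `x`; the tiling is a word in three letters, infinite in both directions. -/
structure IsIntervalTiling (o ℓ : Fin 3 → ℝ) (T : Set ℝ) : Prop where
  pos : ∀ i, 0 < ℓ i
  disj : ∀ {i j x y}, x - o i ∈ T → y - o j ∈ T → x < y → x + ℓ i ≤ y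
  inj : ∀ {i j x}, x - o i ∈ T → x - o j ∈ T → i = j
  cover : ∀ x, ∃ i s, s - o i ∈ T ∧ s ≤ x ∧ x < s + ℓ i

theorem Set.OrdConnected.exists_ae_eq_Ico {A : Set ℝ} (hA : A.OrdConnected) (h0 : 0 < volume A)
    (hfin : volume A ≠ ⊤) :
    ∃ α ℓ : ℝ, 0 < ℓ ∧ A =ᵐ[volume] Set.Ico α (α + ℓ) := by
  have hne : A.Nonempty := nonempty_of_measure_ne_zero h0.ne'
  have hconn : IsConnected A := ⟨hne, hA.isPreconnected⟩
  obtain ⟨x, hx⟩ := hne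
  have hba : BddAbove A := by
    by_contra hcon
    refine hfin (top_unique ?_)
    rw [← Real.volume_Ici (a := x)]
    refine measure_mono fun y hy => ?_
    rw [not_bddAbove_iff] at hcon
    obtain ⟨z, hz, hyz⟩ := hcon y
    exact hA.out hx hz ⟨hy, hyz.le⟩
  have hbb : BddBelow A := by
    by_contra hcon
    refine hfin (top_unique ?_)
    rw [← Real.volume_Iic (a := x)]
    refine measure_mono fun y hy => ?_
    rw [not_bddBelow_iff] at hcon
    obtain ⟨z, hz, hyz⟩ := hcon y
    exact hA.out hz hx ⟨hyz.le, hy⟩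
  have hsub := subset_Icc_csInf_csSup hbb hba
  have hsup := hconn.Ioo_csInf_csSup_subset hbb hba
  have hlt : sInf A < sSup A := by
    by_contra hcon
    have := (measure_mono hsub).trans_eq (Real.volume_Icc)
    rw [ENNReal.ofReal_of_nonpos (by linarith)] at this
    exact h0.ne' (le_antisymm this bot_le)
  refine ⟨sInf A, sSup A - sInf A, by linarith, ?_⟩
  rw [add_sub_cancel]
  have h1 : Set.Ioo (sInf A) (sSup A) =ᵐ[volume] Set.Icc (sInf A) (sSup A) := Ioo_ae_eq_Icc
  have h2 : A =ᵐ[volume] Set.Icc (sInf A) (sSup A) :=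
    (Filter.EventuallyLE.antisymm hsub.eventuallyLE (h1.symm.le.trans hsup.eventuallyLE))
  exact h2.trans Ico_ae_eq_Icc.symm

theorem le_of_volume_Ico_inter_Ico_eq_zero {a b c d : ℝ} (hcd : c < d) (hac : a ≤ c)
    (h : volume (Set.Ico a b ∩ Set.Ico c d) = 0) : b ≤ c := by
  rw [Set.Ico_inter_Ico, Real.volume_Ico, ENNReal.ofReal_eq_zero, sup_eq_right.2 hac] at h
  by_contra hcon
  have : c < b ⊓ d := lt_inf_iff.2 ⟨by linarith, hcd⟩
  linarith

/-- Points with mutual distances bounded below are finite in number in each bounded interval. -/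
theorem finite_inter_Icc_of_separated {T : Set ℝ} {δ : ℝ} (hδ : 0 < δ)
    (hT : ∀ s ∈ T, ∀ t ∈ T, s < t → s + δ ≤ t) (a b : ℝ) : (T ∩ Set.Icc a b).Finite := by
  refine Set.Finite.of_finite_image (f := fun x => ⌊x / δ⌋) ?_ ?_
  · refine (Set.finite_Icc ⌊a / δ⌋ ⌊b / δ⌋).subset ?_
    rintro _ ⟨x, ⟨-, hx⟩, rfl⟩
    exact ⟨Int.floor_le_floor (by gcongr; exact hx.1), Int.floor_le_floor (by gcongr; exact hx.2)⟩
  · have aux : ∀ x ∈ T, ∀ y ∈ T, ⌊x / δ⌋ = ⌊y / δ⌋ → ¬ x < y := by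
      intro x hx y hy hxy hlt
      have h1 := hT x hx y hy hlt
      have h2 : x / δ + 1 ≤ y / δ := by
        rw [← sub_nonneg]
        have : y / δ - (x / δ + 1) = (y - (x + δ)) / δ := by field_simp
        rw [this]; exact div_nonneg (by linarith) hδ.le
      have h3 := Int.floor_le_floor h2
      rw [Int.floor_add_one] at h3
      omega
    intro x hx y hy hxy
    exact le_antisymm (not_lt.1 (aux y hy.1 x hx.1 hxy.symm)) (not_lt.1 (aux x hx.1 y hy.1 hxy))

theorem countable_of_separated {T : Set ℝ} {δ : ℝ} (hδ : 0 < δ)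
    (hT : ∀ s ∈ T, ∀ t ∈ T, s < t → s + δ ≤ t) : T.Countable := by
  have : T = ⋃ n : ℕ, T ∩ Set.Icc (-n : ℝ) n := by
    ext x
    simp only [Set.mem_iUnion, Set.mem_inter_iff, Set.mem_Icc]
    constructor
    · intro hx
      obtain ⟨n, hn⟩ := exists_nat_ge |x|
      exact ⟨n, hx, abs_le.1 hn⟩
    · rintro ⟨n, hx, -⟩; exact hx
  rw [this]
  exact Set.countable_iUnion fun n => (finite_inter_Icc_of_separated hδ hT _ _).countable

theorem measurableSet_intervalUnion (o ℓ : Fin 3 → ℝ) : MeasurableSet (intervalUnion o ℓ) :=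
  MeasurableSet.iUnion fun _ => measurableSet_Ico

theorem isBounded_intervalUnion (o ℓ : Fin 3 → ℝ) : Bornology.IsBounded (intervalUnion o ℓ) :=
  Bornology.isBounded_iUnion.2 fun _ => Metric.isBounded_Ico _ _

theorem image_add_right_ae_eq {Ω Ω' : Set ℝ} (h : Ω =ᵐ[volume] Ω') (t : ℝ) :
    (fun x => x + t) '' Ω =ᵐ[volume] (fun x => x + t) '' Ω' := by
  simp only [Set.image_add_right]
  exact (measurePreserving_add_right volume (-t)).quasiMeasurePreserving.preimage_ae_eq h

/-- A tiling up to null sets of a union of half-open intervals is an exact tiling: half-open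
intervals with null intersection are disjoint, and an uncovered point would be the left endpoint
of an uncovered interval, because the translates are locally finite. -/
theorem isIntervalTiling_of_isTilingPair {Ω : Set ℝ} {o ℓ : Fin 3 → ℝ} {T : Set ℝ}
    (hpos : ∀ i, 0 < ℓ i) (hΩ : Ω =ᵐ[volume] intervalUnion o ℓ)
    (hdisj : ∀ i j, i ≠ j →
      volume (Set.Ico (o i) (o i + ℓ i) ∩ Set.Ico (o j) (o j + ℓ j)) = 0)
    (hT : IsTilingPair Ω T) : IsIntervalTiling o ℓ T := by
  obtain ⟨hpack, hcov⟩ := hT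
  have himg : ∀ i t x, x ∈ Set.Ico (t + o i) (t + o i + ℓ i) →
      x ∈ (fun x => x + t) '' intervalUnion o ℓ := by
    intro i t x hx
    refine ⟨x - t, Set.mem_iUnion.2 ⟨i, ?_, ?_⟩, by simp⟩ <;> linarith [hx.1, hx.2]
  have hnull : ∀ i j, ∀ t ∈ T, ∀ s ∈ T, (i ≠ j ∨ t ≠ s) →
      volume (Set.Ico (t + o i) (t + o i + ℓ i) ∩ Set.Ico (s + o j) (s + o j + ℓ j)) = 0 := by
    intro i j t ht s hs hne
    by_cases hts : t = s
    · subst hts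
      have hij := hne.resolve_right (by simp)
      have h1 := hdisj i j hij
      rw [Set.Ico_inter_Ico, Real.volume_Ico] at h1 ⊢
      rw [← h1]
      congr 1
      rw [add_assoc, add_assoc, min_add_add_left, max_add_add_left]
      ring
    · have h1 := hpack ht hs hts
      have h2 := measure_congr ((image_add_right_ae_eq hΩ t).inter (image_add_right_ae_eq hΩ s))
      rw [h1] at h2
      exact measure_mono_null
        (Set.inter_subset_inter (fun x hx => himg i t x hx) (fun x hx => himg j s x hx)) h2.symm
  have hd : ∀ {i j x y}, x - o i ∈ T → y - o j ∈ T → x < y → x + ℓ i ≤ y := by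
    intro i j x y hx hy hxy
    have h1 := hnull i j _ hx _ hy (by
      by_contra hcon
      push Not at hcon
      obtain ⟨rfl, h⟩ := hcon
      linarith)
    rw [sub_add_cancel, sub_add_cancel] at h1
    exact le_of_volume_Ico_inter_Ico_eq_zero (by linarith [hpos j]) hxy.le h1
  have hsep : ∀ s ∈ T, ∀ t ∈ T, s < t → s + ℓ 0 ≤ t := by
    intro s hs t ht hst
    have := hd (i := 0) (j := 0) (x := s + o 0) (y := t + o 0) (by simpa) (by simpa) (by linarith)
    linarith
  refine ⟨hpos, hd, ?_, ?_⟩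
  · intro i j x hx hy
    by_contra hij
    have h1 := hnull i j _ hx _ hy (Or.inl hij)
    rw [sub_add_cancel, sub_add_cancel] at h1
    have := le_of_volume_Ico_inter_Ico_eq_zero (by linarith [hpos j]) le_rfl h1
    linarith [hpos i]
  · intro x
    by_contra hcon
    push Not at hcon
    have hcount := countable_of_separated (hpos 0) hsep
    have hcov' : volume (⋃ t ∈ T, (fun x => x + t) '' intervalUnion o ℓ)ᶜ = 0 := by
      rw [← hcov]
      exact measure_congr (Filter.EventuallyEq.compl
        (Filter.EventuallyEq.countable_bUnion hcount fun t _ => (image_add_right_ae_eq hΩ t).symm))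
    have hfin : ∀ i, {y | y - o i ∈ T ∧ y ∈ Set.Icc x (x + 1)}.Finite := by
      intro i
      refine finite_inter_Icc_of_separated (T := {y | y - o i ∈ T}) (hpos 0) ?_ x (x + 1)
      intro s hs t ht hst
      have := hsep _ hs _ ht (by linarith)
      linarith
    have hclosed := (Set.finite_iUnion hfin).isClosed
    have hx : x ∈ (⋃ i, {y | y - o i ∈ T ∧ y ∈ Set.Icc x (x + 1)})ᶜ := by
      simp only [Set.mem_compl_iff, Set.mem_iUnion, Set.mem_ofPred_eq, not_exists]
      rintro i ⟨hi, -⟩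
      linarith [hcon i x hi le_rfl, hpos i]
    obtain ⟨ε, hε, hball⟩ := Metric.isOpen_iff.1 hclosed.isOpen_compl x hx
    have hsub : Set.Ico x (x + min ε 1) ⊆ (⋃ t ∈ T, (fun x => x + t) '' intervalUnion o ℓ)ᶜ := by
      intro y hy hyc
      simp only [Set.mem_iUnion] at hyc
      obtain ⟨t, ht, z, hz, rfl⟩ := hyc
      obtain ⟨i, hzi⟩ := Set.mem_iUnion.1 hz
      have hst : (o i + t) - o i ∈ T := by simpa
      have hy1 := hy.1
      have hy2 := hy.2
      simp only at hy1 hy2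
      rcases le_or_gt (o i + t) x with hle | hlt
      · have := hcon i _ hst hle
        linarith [hzi.2]
      · have hm1 := min_le_left ε 1
        have hm2 := min_le_right ε 1
        have hmem : o i + t ∈ Metric.ball x ε := by
          rw [Metric.mem_ball, Real.dist_eq, abs_of_pos (by linarith)]
          linarith [hzi.1]
        exact hball hmem (Set.mem_iUnion.2 ⟨i, hst, hlt.le, by linarith [hzi.1]⟩)
    have hm := measure_mono_null hsub hcov'
    rw [Real.volume_Ico, ENNReal.ofReal_eq_zero] at hm
    have : 0 < min ε 1 := lt_min hε one_pos
    linarith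

theorem exists_isIntervalTiling {A B C : Set ℝ}
    (hA : A.OrdConnected) (hB : B.OrdConnected) (hC : C.OrdConnected)
    (hA0 : 0 < volume A) (hB0 : 0 < volume B) (hC0 : 0 < volume C)
    (hAB : Disjoint A B) (hAC : Disjoint A C) (hBC : Disjoint B C)
    (hlen : volume A + volume B + volume C = 1)
    (htile : TilesByTranslations (A ∪ B ∪ C)) :
    ∃ o ℓ T, IsIntervalTiling o ℓ T ∧ ℓ 0 + ℓ 1 + ℓ 2 = 1 ∧
      volume (intervalUnion o ℓ) = 1 ∧ (A ∪ B ∪ C : Set ℝ) =ᵐ[volume] intervalUnion o ℓ := by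
  have hfin : volume A ≠ ⊤ ∧ volume B ≠ ⊤ ∧ volume C ≠ ⊤ := by
    refine ⟨?_, ?_, ?_⟩ <;> intro h <;> simp [h] at hlen
  obtain ⟨α, a, ha, hAe⟩ := hA.exists_ae_eq_Ico hA0 hfin.1
  obtain ⟨β, b, hb, hBe⟩ := hB.exists_ae_eq_Ico hB0 hfin.2.1
  obtain ⟨γ, c, hc, hCe⟩ := hC.exists_ae_eq_Ico hC0 hfin.2.2
  obtain ⟨T, hT⟩ := htile
  have hU : intervalUnion ![α, β, γ] ![a, b, c]
      = Set.Ico α (α + a) ∪ Set.Ico β (β + b) ∪ Set.Ico γ (γ + c) := by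
    ext x
    simp [intervalUnion, Fin.exists_fin_succ, or_assoc]
  have hae : (A ∪ B ∪ C : Set ℝ) =ᵐ[volume] intervalUnion ![α, β, γ] ![a, b, c] := by
    rw [hU]
    exact (hAe.union hBe).union hCe
  have hvol : ∀ {D : Set ℝ} {δ d : ℝ}, D =ᵐ[volume] Set.Ico δ (δ + d) →
      volume D = ENNReal.ofReal d := by
    intro D δ d h
    rw [measure_congr h, Real.volume_Ico, add_sub_cancel_left]
  have hnull : ∀ {D E : Set ℝ} {δ d ε e : ℝ}, Disjoint D E → D =ᵐ[volume] Set.Ico δ (δ + d) →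
      E =ᵐ[volume] Set.Ico ε (ε + e) →
      volume (Set.Ico δ (δ + d) ∩ Set.Ico ε (ε + e)) = 0 ∧
      volume (Set.Ico ε (ε + e) ∩ Set.Ico δ (δ + d)) = 0 := by
    intro D E δ d ε e hDE hD hE
    have : volume (Set.Ico δ (δ + d) ∩ Set.Ico ε (ε + e)) = 0 := by
      rw [← measure_congr (hD.inter hE), hDE.inter_eq, measure_empty]
    exact ⟨this, by rwa [Set.inter_comm]⟩
  refine ⟨![α, β, γ], ![a, b, c], T, ?_, ?_, ?_, hae⟩
  · refine isIntervalTiling_of_isTilingPair ?_ hae ?_ hT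
    · intro i; fin_cases i <;> assumption
    · intro i j hij
      fin_cases i <;> fin_cases j
      · exact absurd rfl hij
      · exact (hnull hAB hAe hBe).1
      · exact (hnull hAC hAe hCe).1
      · exact (hnull hAB hAe hBe).2
      · exact absurd rfl hij
      · exact (hnull hBC hBe hCe).1
      · exact (hnull hAC hAe hCe).2
      · exact (hnull hBC hBe hCe).2
      · exact absurd rfl hij
  · rw [hvol hAe, hvol hBe, hvol hCe, ← ENNReal.ofReal_add ha.le hb.le,
      ← ENNReal.ofReal_add (by positivity) hc.le, ENNReal.ofReal_eq_one] at hlen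
    simpa using hlen
  · rw [← measure_congr hae, measure_union (by simp [hAC, hBC]) hC.measurableSet,
      measure_union hAB hB.measurableSet, hlen]

/-! ### Words without repeated letters -/

theorem Fin.eq_or_eq_or_eq_of_ne {i j k : Fin 3} (hij : i ≠ j) (hik : i ≠ k) (hjk : j ≠ k)
    (m : Fin 3) : m = i ∨ m = j ∨ m = k := by
  revert i j k m; decide

namespace IsIntervalTiling

variable {o ℓ : Fin 3 → ℝ} {T : Set ℝ}

/-- A point lies in one translate only. -/
theorem eq_of_mem (h : IsIntervalTiling o ℓ T) {i j : Fin 3} {x y z : ℝ} (hy : y - o i ∈ T)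
    (hz : z - o j ∈ T) (hy1 : y ≤ x) (hy2 : x < y + ℓ i) (hz1 : z ≤ x) (hz2 : x < z + ℓ j) :
    y = z ∧ i = j := by
  rcases lt_trichotomy y z with hlt | rfl | hlt
  · linarith [h.disj hy hz hlt]
  · exact ⟨rfl, h.inj hy hz⟩
  · linarith [h.disj hz hy hlt]

theorem next (h : IsIntervalTiling o ℓ T) {i : Fin 3} {x : ℝ} (hx : x - o i ∈ T) :
    ∃ j, x + ℓ i - o j ∈ T := by
  obtain ⟨j, s, hs, h1, h2⟩ := h.cover (x + ℓ i)
  rcases h1.lt_or_eq with hlt | rfl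
  · rcases lt_trichotomy x s with hxs | rfl | hxs
    · linarith [h.disj hx hs hxs]
    · obtain rfl := h.inj hx hs
      linarith
    · linarith [h.disj hs hx hxs, h.pos i]
  · exact ⟨j, hs⟩

theorem prev (h : IsIntervalTiling o ℓ T) {i : Fin 3} {x : ℝ} (hx : x - o i ∈ T) :
    ∃ j, x - ℓ j - o j ∈ T := by
  obtain ⟨m, hm⟩ := Finite.exists_min ℓ
  obtain ⟨j, s, hs, h1, h2⟩ := h.cover (x - ℓ m)
  have h3 := h.disj hs hx (by linarith [h.pos m])
  rcases h3.lt_or_eq with hlt | heq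
  · obtain ⟨j', hj'⟩ := h.next hs
    linarith [h.disj hj' hx hlt, hm j']
  · exact ⟨j, by rwa [show x - ℓ j = s by linarith]⟩

theorem separated (h : IsIntervalTiling o ℓ T) (i : Fin 3) {s t : ℝ} (hs : s ∈ T) (ht : t ∈ T)
    (hst : s < t) : s + ℓ i ≤ t := by
  have := h.disj (i := i) (j := i) (x := s + o i) (y := t + o i) (by simpa) (by simpa) (by linarith)
  linarith

theorem nonempty (h : IsIntervalTiling o ℓ T) : T.Nonempty := by
  obtain ⟨i, s, hs, -⟩ := h.cover 0
  exact ⟨_, hs⟩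

/-- If a letter is repeated, the space between the corresponding copies of another letter `j`
is either empty or filled by a single copy of the third letter. -/
theorem length_eq_of_repeat (h : IsIntervalTiling o ℓ T) {i j k : Fin 3} (hij : i ≠ j)
    (hik : i ≠ k) (hjk : j ≠ k) {x : ℝ} (hx : x - o i ∈ T) (hx' : x + ℓ i - o i ∈ T) :
    ℓ j = ℓ i ∨ ℓ i = ℓ j + ℓ k := by
  obtain ⟨y, hy⟩ : ∃ y, y = x - o i + o j := ⟨_, rfl⟩
  have hy1 : y - o j ∈ T := by rwa [show y - o j = x - o i by linarith]
  have hy2 : y + ℓ i - o j ∈ T := by rwa [show y + ℓ i - o j = x + ℓ i - o i by linarith]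
  have hle := h.disj hy1 hy2 (by linarith [h.pos i])
  rcases hle.lt_or_eq with hlt | heq
  swap
  · left; linarith
  obtain ⟨m, hm⟩ := h.next hy1
  rcases Fin.eq_or_eq_or_eq_of_ne hij hik hjk m with rfl | rfl | rfl
  · linarith [h.disj hm hy2 hlt, h.pos j]
  · linarith [h.separated i hy1 hm (by linarith [h.pos m])]
  have hle := h.disj hm hy2 hlt
  rcases hle.lt_or_eq with hlt2 | heq
  swap
  · right; linarith
  obtain ⟨n, hn⟩ := h.next hm
  rcases Fin.eq_or_eq_or_eq_of_ne hij hik hjk n with rfl | rfl | rfl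
  · linarith [h.disj hn hy2 hlt2, h.pos j, h.pos m]
  · linarith [h.separated i hy1 hn (by linarith [h.pos n, h.pos m])]
  · linarith [h.separated i hm hn (by linarith [h.pos n]), h.pos j]

/-- In a word without repeated letters, a subword `j k j` leaves room for exactly one letter
between the corresponding copies of `i`. -/
theorem length_eq_of_alternate (h : IsIntervalTiling o ℓ T)
    (hrep : ∀ m x, x - o m ∈ T → x + ℓ m - o m ∉ T) {i j k : Fin 3} (hij : i ≠ j)
    (hik : i ≠ k) (hjk : j ≠ k) {z : ℝ} (hz : z - o j ∈ T) (hz1 : z + ℓ j - o k ∈ T)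
    (hz2 : z + ℓ j + ℓ k - o j ∈ T) : ℓ i = ℓ k ∨ ℓ i = ℓ j := by
  have hcons : ∀ u ∈ T, z - o j < u → ¬ u < z - o j + ℓ j + ℓ k := by
    intro u hu h1 h2
    have hu' : u + o j - o j ∈ T := by simpa
    have h3 := h.disj hz hu' (by linarith)
    have h4 := h.eq_of_mem (x := u + o j) hu' hz1 le_rfl (by linarith [h.pos j]) h3 (by linarith)
    exact hjk h4.2
  obtain ⟨y, hy⟩ : ∃ y, y = z - o j + o i := ⟨_, rfl⟩
  have hy1 : y - o i ∈ T := by rwa [show y - o i = z - o j by linarith]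
  have hy2 : y + ℓ j + ℓ k - o i ∈ T := by
    rwa [show y + ℓ j + ℓ k - o i = z + ℓ j + ℓ k - o j by linarith]
  have hpj := h.pos j
  have hpk := h.pos k
  have hpi := h.pos i
  rcases (h.disj hy1 hy2 (by linarith)).lt_or_eq with hlt | heq
  swap
  · exact absurd (heq ▸ hy2) (hrep i y hy1)
  obtain ⟨m, hm⟩ := h.next hy1
  rcases Fin.eq_or_eq_or_eq_of_ne hij hik hjk m with rfl | rfl | rfl
  · exact absurd hm (hrep m y hy1)
  · rcases (h.disj hm hy2 hlt).lt_or_eq with hlt2 | heq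
    swap
    · left; linarith
    obtain ⟨n, hn⟩ := h.next hm
    rcases Fin.eq_or_eq_or_eq_of_ne hij hik hjk n with rfl | rfl | rfl
    · exact absurd (by linarith) (hcons _ hn (by linarith))
    · exact absurd hn (hrep n _ hm)
    · linarith [h.disj hn hy2 hlt2]
  · rcases (h.disj hm hy2 hlt).lt_or_eq with hlt2 | heq
    swap
    · right; linarith
    obtain ⟨n, hn⟩ := h.next hm
    rcases Fin.eq_or_eq_or_eq_of_ne hij hik hjk n with rfl | rfl | rfl
    · exact absurd (by linarith) (hcons _ hn (by linarith))
    · linarith [h.disj hn hy2 hlt2]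
    · exact absurd hn (hrep n _ hm)

/-- In a word without repeated letters, a letter `i` whose length differs from the two others
returns after one or two other letters, and in the latter case after distance one. -/
theorem gap_of_no_repeat (h : IsIntervalTiling o ℓ T)
    (hrep : ∀ m x, x - o m ∈ T → x + ℓ m - o m ∉ T) {i j k : Fin 3} (hij : i ≠ j)
    (hik : i ≠ k) (hjk : j ≠ k) (hlj : ℓ i ≠ ℓ j) (hlk : ℓ i ≠ ℓ k) {t : ℝ} (ht : t ∈ T) :
    t + (ℓ i + ℓ j + ℓ k) ∈ T ∨ t + (ℓ i + ℓ j) ∈ T ∨ t + (ℓ i + ℓ k) ∈ T := by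
  have hx : t + o i - o i ∈ T := by simpa
  obtain ⟨m, hm⟩ := h.next hx
  obtain ⟨n, hn⟩ := h.next hm
  obtain ⟨p, hp⟩ := h.next hn
  rcases Fin.eq_or_eq_or_eq_of_ne hij hik hjk m with rfl | rfl | rfl
  · exact absurd hm (hrep _ _ hx)
  · rcases Fin.eq_or_eq_or_eq_of_ne hij hik hjk n with rfl | rfl | rfl
    · right; left; convert hn using 1; ring
    · exact absurd hn (hrep _ _ hm)
    · rcases Fin.eq_or_eq_or_eq_of_ne hij hik hjk p with rfl | rfl | rfl
      · left; convert hp using 1; ring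
      · rcases h.length_eq_of_alternate hrep hij hik hjk hm hn hp with h1 | h1
        · exact absurd h1 hlk
        · exact absurd h1 hlj
      · exact absurd hp (hrep _ _ hn)
  · rcases Fin.eq_or_eq_or_eq_of_ne hij hik hjk n with rfl | rfl | rfl
    · right; right; convert hn using 1; ring
    · rcases Fin.eq_or_eq_or_eq_of_ne hij hik hjk p with rfl | rfl | rfl
      · left; convert hp using 1; ring
      · exact absurd hp (hrep _ _ hn)
      · rcases h.length_eq_of_alternate hrep hik hij hjk.symm hm hn hp with h1 | h1
        · exact absurd h1 hlj
        · exact absurd h1 hlk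
    · exact absurd hn (hrep _ _ hm)

theorem eq_of_add_mem (h : IsIntervalTiling o ℓ T) {s t x y : ℝ} (hs : s ∈ T) (ht : t ∈ T)
    (hx : x ∈ intervalUnion o ℓ) (hy : y ∈ intervalUnion o ℓ) (hxy : x + s = y + t) : s = t := by
  obtain ⟨i, hi1, hi2⟩ := Set.mem_iUnion.1 hx
  obtain ⟨j, hj1, hj2⟩ := Set.mem_iUnion.1 hy
  obtain ⟨h1, rfl⟩ := h.eq_of_mem (i := i) (j := j) (x := x + s) (y := s + o i) (z := t + o j) (by simpa) (by simpa)
    (by linarith) (by linarith) (by linarith) (by linarith)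
  linarith

/-- Translates of a set of measure one that do not overlap have density at most one. -/
theorem exists_card_le (h : IsIntervalTiling o ℓ T) (hv : volume (intervalUnion o ℓ) = 1) :
    ∃ D : ℝ, ∀ f : ℕ → ℝ, StrictMono f → (∀ n, f n ∈ T) → ∀ n : ℕ, n ≤ f n - f 0 + D := by
  obtain ⟨R, hR⟩ := (isBounded_intervalUnion o ℓ).exists_norm_le
  have hR0 : 0 ≤ R := by
    have : (intervalUnion o ℓ).Nonempty := nonempty_of_measure_ne_zero (μ := volume) (by simp [hv])
    obtain ⟨x, hx⟩ := this
    exact (norm_nonneg x).trans (hR x hx)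
  refine ⟨2 * R, fun f hf hfT n => ?_⟩
  have hsub : (⋃ m ∈ Finset.range n, (fun x => x + f m) '' intervalUnion o ℓ)
      ⊆ Set.Icc (f 0 - R) (f n + R) := by
    intro x hx
    simp only [Set.mem_iUnion, Finset.mem_range] at hx
    obtain ⟨m, hm, y, hy, rfl⟩ := hx
    have h1 := abs_le.1 (hR y hy)
    have h2 := hf.monotone (Nat.zero_le m)
    have h3 := hf.monotone hm.le
    constructor <;> simp only <;> linarith
  have hle := measure_mono (μ := volume) hsub
  rw [measure_biUnion_finset] at hle
  · have himg : ∀ t : ℝ, volume ((fun x => x + t) '' intervalUnion o ℓ) = 1 := fun t => by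
      rw [Set.image_add_right, measure_preimage_add_right, hv]
    simp only [himg, Finset.sum_const, Finset.card_range, Real.volume_Icc, nsmul_eq_mul,
      mul_one] at hle
    have h0 := hf.monotone (Nat.zero_le n)
    rw [← ENNReal.ofReal_natCast, ENNReal.ofReal_le_ofReal_iff (by linarith)] at hle
    linarith
  · intro m _ m' _ hmm
    rw [Function.onFun, Set.disjoint_left]
    rintro _ ⟨x, hx, rfl⟩ ⟨y, hy, hxy⟩
    exact hmm (hf.injective (h.eq_of_add_mem (hfT m) (hfT m') hx hy hxy.symm))
  · intro m _
    rw [Set.image_add_right]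
    exact measurableSet_preimage (measurable_add_const _) (measurableSet_intervalUnion o ℓ)

/-- If no gap of `T` is longer than one and the gaps other than one are bounded away from it, then
only finitely many gaps to the right of a point are different from one: each of them increases the
density, which is at most one. -/
theorem exists_add_nat_mem (h : IsIntervalTiling o ℓ T) (hv : volume (intervalUnion o ℓ) = 1)
    {η : ℝ} (hη : 0 < η)
    (hgap : ∀ t ∈ T, t + 1 ∈ T ∨ ∃ u ∈ T, t < u ∧ u ≤ t + 1 - η) :
    ∃ t ∈ T, ∀ k : ℕ, t + k ∈ T := by
  have hstep : ∀ t : T, ∃ u : T, t.1 < u.1 ∧ (u.1 = t.1 + 1 ∨ u.1 ≤ t.1 + 1 - η) := by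
    rintro ⟨t, ht⟩
    rcases hgap t ht with h1 | ⟨u, hu, h1, h2⟩
    · exact ⟨⟨_, h1⟩, by simp, Or.inl rfl⟩
    · exact ⟨⟨u, hu⟩, h1, Or.inr h2⟩
  choose g hg1 hg2 using hstep
  obtain ⟨t₀, ht₀⟩ := h.nonempty
  obtain ⟨f, hf⟩ : ∃ f : ℕ → T, ∀ n, f (n + 1) = g (f n) :=
    ⟨fun n => g^[n] ⟨t₀, ht₀⟩, fun n => Function.iterate_succ_apply' _ _ _⟩
  have hmono : StrictMono fun n => (f n : ℝ) := strictMono_nat_of_lt_succ fun n => by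
    rw [hf]; exact hg1 _
  obtain ⟨D, hD⟩ := h.exists_card_le hv
  have hD' := hD (fun n => (f n : ℝ)) hmono fun n => (f n).2
  by_contra hcon
  push Not at hcon
  have hshort : ∀ N, ∃ n, N ≤ n ∧ (f (n + 1) : ℝ) ≤ f n + 1 - η := by
    intro N
    by_contra hno
    push Not at hno
    have hall : ∀ k : ℕ, (f (N + k) : ℝ) = f N + k := by
      intro k
      induction k with
      | zero => simp
      | succ k ih =>
        have h1 := hno (N + k) (by omega)
        have h2 := hg2 (f (N + k))
        rw [← hf] at h2
        rw [← add_assoc, h2.resolve_right (not_le.2 h1), ih]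
        push_cast; ring
    obtain ⟨k, hk⟩ := hcon _ (f N).2
    exact hk (hall k ▸ (f (N + k)).2)
  -- the excess `n - (f n - f 0)` of the number of translations over the distance
  have hdef : Monotone fun n : ℕ => (n : ℝ) - f n := monotone_nat_of_le_succ fun n => by
    have h2 := hg2 (f n)
    rw [← hf] at h2
    push_cast
    rcases h2 with h2 | h2 <;> linarith
  have hgrow : ∀ m : ℕ, ∃ n : ℕ, m * η - f 0 ≤ (n : ℝ) - f n := by
    intro m
    induction m with
    | zero => exact ⟨0, by simp⟩
    | succ m ih =>
      obtain ⟨N, hN⟩ := ih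
      obtain ⟨n, hn, hs⟩ := hshort N
      refine ⟨n + 1, ?_⟩
      have := hdef hn
      simp only at this
      push_cast
      linarith
  obtain ⟨m, hm⟩ := exists_nat_gt (D / η)
  rw [div_lt_iff₀ hη] at hm
  obtain ⟨n, hn⟩ := hgrow m
  have := hD' n
  linarith

/-- The translates by `t + k`, `k : ℕ`, show that the translates by `ℤ` do not overlap, and `ℤ` is
a spectrum. -/
theorem isSpectralSet_of_add_nat_mem (h : IsIntervalTiling o ℓ T)
    (hv : volume (intervalUnion o ℓ) = 1) {t : ℝ} (ht : t ∈ T) (hk : ∀ k : ℕ, t + k ∈ T) :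
    IsSpectralSet (intervalUnion o ℓ) := by
  refine isSpectralSet_of_fold (measurableSet_intervalUnion o ℓ) (isBounded_intervalUnion o ℓ) hv
    one_pos 0 ?_
  intro x hx y hy hxy k hxyk
  exfalso
  apply hxy
  rw [Nat.cast_one, div_one] at hxyk
  obtain ⟨n, rfl | rfl⟩ := k.eq_nat_or_neg
  · have := h.eq_of_add_mem ht (hk n) hx hy (by push_cast at hxyk; linarith)
    push_cast at hxyk; linarith
  · have := h.eq_of_add_mem (hk n) ht hx hy (by push_cast at hxyk; linarith)
    push_cast at hxyk; linarith

theorem isSpectralSet_of_no_repeat (h : IsIntervalTiling o ℓ T)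
    (hv : volume (intervalUnion o ℓ) = 1)
    (hrep : ∀ m x, x - o m ∈ T → x + ℓ m - o m ∉ T) {i j k : Fin 3} (hij : i ≠ j)
    (hik : i ≠ k) (hjk : j ≠ k) (hlen : ℓ i + ℓ j + ℓ k = 1) (hlj : ℓ i ≠ ℓ j) (hlk : ℓ i ≠ ℓ k) :
    IsSpectralSet (intervalUnion o ℓ) := by
  have hpi := h.pos i
  have hpj := h.pos j
  have hpk := h.pos k
  obtain ⟨t, ht, hk⟩ := h.exists_add_nat_mem hv (lt_min hpj hpk) (fun t ht => by
    have h1 := min_le_left (ℓ j) (ℓ k)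
    have h2 := min_le_right (ℓ j) (ℓ k)
    rcases h.gap_of_no_repeat hrep hij hik hjk hlj hlk ht with h3 | h3 | h3
    · left; rwa [hlen] at h3
    · right; exact ⟨_, h3, by linarith, by linarith⟩
    · right; exact ⟨_, h3, by linarith, by linarith⟩)
  exact h.isSpectralSet_of_add_nat_mem hv ht hk

end IsIntervalTiling

/-! ### Periods of tilings of the integers by two and three elements -/

theorem exists_gcd_decomposition {P Q : ℤ} (h : ¬ (P = 0 ∧ Q = 0)) :
    ∃ d P' Q' a b : ℤ, d ≠ 0 ∧ P = d * P' ∧ Q = d * Q' ∧ P' * a + Q' * b = 1 := by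
  have hd : (P.gcd Q : ℤ) ≠ 0 := by
    rw [← Int.gcd_eq_zero_iff] at h
    exact_mod_cast h
  obtain ⟨P', hP'⟩ := Int.gcd_dvd_left P Q
  obtain ⟨Q', hQ'⟩ := Int.gcd_dvd_right P Q
  refine ⟨P.gcd Q, P', Q', P.gcdA Q, P.gcdB Q, hd, hP', hQ', ?_⟩
  have hb := Int.gcd_eq_gcd_ab P Q
  apply mul_left_cancel₀ hd
  linear_combination -hb - P.gcdA Q * hP' - P.gcdB Q * hQ'

/-- For a tiling of `ℤ` by `{0, P, Q}`, with indicator function `f` of the set of translations,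
`P / d`, `Q / d` and `(P - Q) / d` are prime to three, where `d = gcd P Q`. This rests on the
identity `1 + x³ + y³ = (1 + x + y) (1 + x² + y² - x - y - x y) + 3 x y`, which makes `3 P` and
`3 Q` periods of `f`. -/
theorem exists_not_three_dvd_of_tiling {f : ℤ → ℤ} (hf : ∀ n, f n = 0 ∨ f n = 1) {P Q : ℤ}
    (h : ∀ n, f n + f (n - P) + f (n - Q) = 1) :
    ∃ d P' Q' : ℤ, d ≠ 0 ∧ P = d * P' ∧ Q = d * Q' ∧ ¬ 3 ∣ P' ∧ ¬ 3 ∣ Q' ∧ ¬ 3 ∣ P' - Q' := by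
  obtain ⟨d, P', Q', a, b, hd, hP', hQ', hab⟩ := exists_gcd_decomposition (P := P) (Q := Q) (by
    rintro ⟨rfl, rfl⟩
    have := h 0
    simp only [sub_zero] at this
    omega)
  have key : ∀ n, f n + f (n - 3 * P) + f (n - 3 * Q) = 3 * f (n - P - Q) := by
    intro n
    have h1 := h n
    have h2 := h (n - P - P)
    have h3 := h (n - Q - Q)
    have h4 := h (n - P)
    have h5 := h (n - Q)
    have h6 := h (n - P - Q)
    rw [show n - P - P - P = n - 3 * P by ring] at h2
    rw [show n - Q - Q - Q = n - 3 * Q by ring] at h3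
    rw [show n - P - P - Q = n - P - Q - P by ring] at h2
    rw [show n - Q - Q - P = n - P - Q - Q by ring] at h3
    rw [show n - Q - P = n - P - Q by ring] at h5
    linarith
  have hP : Function.Periodic f (3 * P) := fun n => by
    have := key (n + 3 * P)
    rw [add_sub_cancel_right] at this
    rcases hf (n + 3 * P) with a | a <;> rcases hf n with b | b <;>
      rcases hf (n + 3 * P - 3 * Q) with c | c <;> omega
  have hQ : Function.Periodic f (3 * Q) := fun n => by
    have := key (n + 3 * Q)
    rw [add_sub_cancel_right] at this
    rcases hf (n + 3 * Q) with a | a <;> rcases hf n with b | b <;>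
      rcases hf (n + 3 * Q - 3 * P) with c | c <;> omega
  have hD : Function.Periodic f (3 * d) := by
    have h1 := (hP.int_mul a).add_period (hQ.int_mul b)
    have h2 : (a : ℤ) * (3 * P) + b * (3 * Q) = 3 * d := by
      rw [hP', hQ']; linear_combination 3 * d * hab
    simp only [Int.cast_id, h2] at h1
    exact h1
  have hno : ∀ R : ℤ, (R = P ∨ R = Q ∨ R = P - Q) → ¬ Function.Periodic f R := by
    rintro R hR hper
    have hex : ∃ n, f n = 1 := by
      by_contra hcon
      push Not at hcon
      have h0 : ∀ n, f n = 0 := fun n => (hf n).resolve_right (hcon n)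
      have := h 0
      simp [h0] at this
    obtain ⟨n, hn⟩ := hex
    rcases hR with rfl | rfl | rfl
    · have h1 := h (n + R)
      rw [hper n, add_sub_cancel_right] at h1
      rcases hf (n + R - Q) with c | c <;> omega
    · have h1 := h (n + R)
      rw [hper n, add_sub_cancel_right] at h1
      rcases hf (n + R - P) with c | c <;> omega
    · have h1 := h (n + P)
      have h2 := hper n
      rw [show n + (P - Q) = n + P - Q by ring] at h2
      rw [add_sub_cancel_right] at h1
      rcases hf (n + P) with c | c <;> omega
  have hdvd : ∀ R R' : ℤ, R = d * R' → 3 ∣ R' → Function.Periodic f R := by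
    rintro R _ rfl ⟨k, rfl⟩
    have h1 := hD.int_mul k
    have h2 : (k : ℤ) * (3 * d) = d * (3 * k) := by ring
    simp only [Int.cast_id, h2] at h1
    exact h1
  exact ⟨d, P', Q', hd, hP', hQ', fun hc => hno P (by simp) (hdvd _ _ hP' hc),
    fun hc => hno Q (by simp) (hdvd _ _ hQ' hc),
    fun hc => hno (P - Q) (by simp) (hdvd _ _ (by rw [hP', hQ']; ring) hc)⟩

/-- If `{0, P}` and `{0, Q}` tile `ℤ` with the same set of translations, then `P` and `Q` have the
same two-adic valuation. -/
theorem exists_odd_of_tiling {f : ℤ → ℤ} {P Q : ℤ}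
    (h : ∀ n, f n + f (n - P) = 1) (hPQ : ∀ n, f (n - P) = f (n - Q)) :
    ∃ d P' Q' : ℤ, d ≠ 0 ∧ P = d * P' ∧ Q = d * Q' ∧ Odd P' ∧ Odd Q' := by
  obtain ⟨d, P', Q', a, b, hd, hP', hQ', hab⟩ := exists_gcd_decomposition (P := P) (Q := Q) (by
    rintro ⟨rfl, rfl⟩
    have := h 0
    simp only [sub_zero] at this
    omega)
  have hP : Function.Periodic f (2 * P) := fun n => by
    have h1 := h (n + 2 * P)
    have h2 := h (n + P)
    rw [show n + 2 * P - P = n + P by ring] at h1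
    rw [add_sub_cancel_right] at h2
    omega
  have hsub : Function.Periodic f (P - Q) := fun n => by
    have h1 := hPQ (n + P)
    rw [add_sub_cancel_right] at h1
    rw [h1]; congr 1; ring
  refine ⟨d, P', Q', hd, hP', hQ', ?_⟩
  rcases Int.even_or_odd (P' - Q') with he | ⟨k, hk⟩
  · rcases Int.even_or_odd P' with hpe | hpo
    · exfalso
      obtain ⟨u, hu⟩ := hpe
      obtain ⟨v, hv⟩ := he
      have h2 : 2 * (u * a + (u - v) * b) = 1 := by
        have hq : Q' = u + u - (v + v) := by linarith
        rw [hu, hq] at hab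
        linarith
      omega
    · refine ⟨hpo, ?_⟩
      have := hpo.sub_even he
      rwa [sub_sub_cancel] at this
  · exfalso
    -- `(P' - Q') P = P' (P - Q)` is a period, and so is `2 k P`
    have h1 := (hsub.int_mul P').sub_period (hP.int_mul k)
    have h2 : (P' : ℤ) * (P - Q) - k * (2 * P) = P := by
      rw [hP', hQ']; linear_combination d * P' * hk
    simp only [Int.cast_id, h2] at h1
    have h3 := h P
    have h4 := h1 0
    rw [zero_add] at h4
    rw [sub_self] at h3
    omega

namespace IsIntervalTiling

variable {o ℓ : Fin 3 → ℝ} {T : Set ℝ}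

theorem isSpectralSet_of_length_eq_third (h : IsIntervalTiling o ℓ T)
    (hv : volume (intervalUnion o ℓ) = 1) (hℓ : ∀ i, ℓ i = 1 / 3) :
    IsSpectralSet (intervalUnion o ℓ) := by
  obtain ⟨t₀, ht₀⟩ := h.nonempty
  obtain ⟨x₀, hx₀⟩ : ∃ x₀, x₀ = t₀ + o 0 := ⟨_, rfl⟩
  have hgrid : ∀ n : ℤ, ∃ i, x₀ + n / 3 - o i ∈ T := by
    intro n
    induction n using Int.induction_on with
    | zero => exact ⟨0, by simpa [hx₀] using ht₀⟩
    | succ n ih =>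
      obtain ⟨i, hi⟩ := ih
      obtain ⟨j, hj⟩ := h.next hi
      rw [hℓ] at hj
      exact ⟨j, by convert hj using 1; push_cast; ring⟩
    | pred n ih =>
      obtain ⟨i, hi⟩ := ih
      obtain ⟨j, hj⟩ := h.prev hi
      rw [hℓ] at hj
      exact ⟨j, by convert hj using 1; push_cast; ring⟩
  have hall : ∀ i y, y - o i ∈ T → ∃ n : ℤ, y = x₀ + n / 3 := by
    intro i y hy
    refine ⟨⌊3 * (y - x₀)⌋, ?_⟩
    obtain ⟨j, hj⟩ := hgrid ⌊3 * (y - x₀)⌋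
    have h1 := Int.floor_le (3 * (y - x₀))
    have h2 := Int.lt_floor_add_one (3 * (y - x₀))
    exact (h.eq_of_mem hy hj le_rfl (by linarith [h.pos i]) (by linarith)
      (by rw [hℓ]; linarith)).1
  obtain ⟨P, hP⟩ := hall 1 (t₀ + o 1) (by simpa)
  obtain ⟨Q, hQ⟩ := hall 2 (t₀ + o 2) (by simpa)
  classical
  have hex : ∃ d P' Q' : ℤ, d ≠ 0 ∧ P = d * P' ∧ Q = d * Q' ∧ ¬ 3 ∣ P' ∧ ¬ 3 ∣ Q' ∧
      ¬ 3 ∣ P' - Q' := by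
    refine exists_not_three_dvd_of_tiling (f := fun n => if x₀ + n / 3 - o 0 ∈ T then 1 else 0)
      (fun n => by by_cases hn : x₀ + (n : ℝ) / 3 - o 0 ∈ T <;> simp [hn]) (fun n => ?_)
    have e1 : x₀ + ((n - P : ℤ) : ℝ) / 3 - o 0 = x₀ + n / 3 - o 1 := by push_cast; linarith
    have e2 : x₀ + ((n - Q : ℤ) : ℝ) / 3 - o 0 = x₀ + n / 3 - o 2 := by push_cast; linarith
    simp only [e1, e2]
    have hne : ∀ i j, i ≠ j → x₀ + n / 3 - o i ∈ T → x₀ + n / 3 - o j ∉ T :=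
      fun i j hij hi hj => hij (h.inj hi hj)
    obtain ⟨i, hi⟩ := hgrid n
    fin_cases i
    · have h1 := hne 0 1 (by decide) hi
      have h2 := hne 0 2 (by decide) hi
      simp only [Fin.zero_eta] at hi
      simp [hi, h1, h2]
    · have h1 := hne 1 0 (by decide) hi
      have h2 := hne 1 2 (by decide) hi
      simp only [Fin.mk_one] at hi
      simp [hi, h1, h2]
    · have h1 := hne 2 0 (by decide) hi
      have h2 := hne 2 1 (by decide) hi
      simp only [Fin.reduceFinMk] at hi
      simp [hi, h1, h2]
  obtain ⟨d, P', Q', hd, hPd, hQd, hP3, hQ3, hPQ3⟩ := hex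
  have hdR : (d : ℝ) ≠ 0 := by exact_mod_cast hd
  have hrep : ∀ x ∈ intervalUnion o ℓ, ∃ N : ℤ, (N = 0 ∨ N = P' ∨ N = Q') ∧
      o 0 + d * N / 3 ≤ x ∧ x < o 0 + d * N / 3 + 1 / 3 := by
    intro x hx
    obtain ⟨i, hi1, hi2⟩ := Set.mem_iUnion.1 hx
    rw [hℓ] at hi2
    fin_cases i
    · simp only [Fin.zero_eta] at hi1 hi2
      exact ⟨0, by simp, by push_cast; linarith, by push_cast; linarith⟩
    · simp only [Fin.mk_one] at hi1 hi2
      have : (d : ℝ) * P' = P := by rw [hPd]; push_cast; ring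
      exact ⟨P', by simp, by linarith, by linarith⟩
    · simp only [Fin.reduceFinMk] at hi1 hi2
      have : (d : ℝ) * Q' = Q := by rw [hQd]; push_cast; ring
      exact ⟨Q', by simp, by linarith, by linarith⟩
  refine isSpectralSet_of_fold (measurableSet_intervalUnion o ℓ) (isBounded_intervalUnion o ℓ) hv
    (n := 3) (by norm_num) (1 / d) ?_
  intro x hx y hy hxy k hk
  obtain ⟨N, hN, hN1, hN2⟩ := hrep x hx
  obtain ⟨M, hM, hM1, hM2⟩ := hrep y hy
  push_cast at hk
  have hkd : k = d * (N - M) := by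
    have h1 : (k : ℝ) - d * (N - M) < 1 := by linarith
    have h2 : (-1 : ℝ) < k - d * (N - M) := by linarith
    have h1' : k - d * (N - M) < 1 := by exact_mod_cast h1
    have h2' : -1 < k - d * (N - M) := by exact_mod_cast h2
    omega
  have hxy' : (1 / d : ℝ) * (x - y) = ((N - M : ℤ) : ℝ) / 3 := by
    rw [hk, hkd]; push_cast; field_simp
  refine ⟨⟨N - M, by rw [hxy']; push_cast; ring⟩, fun m hm => ?_⟩
  rw [hxy'] at hm
  have hm' : N - M = 3 * m := by
    have : ((N - M : ℤ) : ℝ) = 3 * m := by linarith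
    exact_mod_cast this
  have hNM : N ≠ M := by
    rintro rfl
    rw [sub_self, mul_zero] at hkd
    rw [hkd] at hk
    apply hxy
    simp at hk
    linarith
  rcases hN with rfl | rfl | rfl <;> rcases hM with rfl | rfl | rfl <;> omega

/-- One long interval and two short ones which together form a second layer over it: modulo
`1 / 2`, the intervals `j` and `k` partition the interval `i`. The two layers are shifted by
`d P / 2` and `d Q / 2` with `P`, `Q` odd, so that `exp (2 π i x / d)` changes sign from one layer
to the other. -/
theorem isSpectralSet_of_two_sheets (hv : volume (intervalUnion o ℓ) = 1) {i j k : Fin 3}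
    (hij : i ≠ j) (hik : i ≠ k) (hjk : j ≠ k) (hi : ℓ i = 1 / 2) (hjk' : ℓ j + ℓ k = 1 / 2)
    (hj : 0 < ℓ j) (hk : 0 < ℓ k)
    {d P Q : ℤ} (hd : d ≠ 0) (hP : Odd P) (hQ : Odd Q) (hoj : o j = o i + (d * P : ℝ) / 2)
    (hok : o k = o i + ℓ j + (d * Q : ℝ) / 2) :
    IsSpectralSet (intervalUnion o ℓ) := by
  have hdR : (d : ℝ) ≠ 0 := by exact_mod_cast hd
  have hrep : ∀ x ∈ intervalUnion o ℓ, ∃ (N : ℤ) (r : ℝ), 0 ≤ r ∧ r < 1 / 2 ∧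
      x = o i + d * N / 2 + r ∧ (N = 0 ∨ (N = P ∧ r < ℓ j) ∨ (N = Q ∧ ℓ j ≤ r)) := by
    intro x hx
    obtain ⟨m, hm1, hm2⟩ := Set.mem_iUnion.1 hx
    rcases Fin.eq_or_eq_or_eq_of_ne hij hik hjk m with rfl | rfl | rfl
    · exact ⟨0, x - o m, by linarith, by linarith, by push_cast; ring, Or.inl rfl⟩
    · exact ⟨P, x - o m, by linarith, by linarith, by rw [hoj]; ring,
        Or.inr (Or.inl ⟨rfl, by linarith⟩)⟩
    · exact ⟨Q, x - o m + ℓ j, by linarith, by linarith, by rw [hok]; ring,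
        Or.inr (Or.inr ⟨rfl, by linarith⟩)⟩
  refine isSpectralSet_of_fold (measurableSet_intervalUnion o ℓ) (isBounded_intervalUnion o ℓ) hv
    (n := 2) (by norm_num) (1 / d) ?_
  intro x hx y hy hxy k' hk'
  obtain ⟨N, r, hr1, hr2, hxr, hN⟩ := hrep x hx
  obtain ⟨M, s, hs1, hs2, hys, hM⟩ := hrep y hy
  push_cast at hk'
  have hkd : k' = d * (N - M) := by
    have h1 : (k' : ℝ) - d * (N - M) < 1 := by linarith
    have h2 : (-1 : ℝ) < k' - d * (N - M) := by linarith
    have h1' : k' - d * (N - M) < 1 := by exact_mod_cast h1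
    have h2' : -1 < k' - d * (N - M) := by exact_mod_cast h2
    omega
  have hrs : r = s := by
    have : (k' : ℝ) = d * (N - M) := by exact_mod_cast hkd
    linarith
  have hxy' : (1 / d : ℝ) * (x - y) = ((N - M : ℤ) : ℝ) / 2 := by
    rw [hk', hkd]; push_cast; field_simp
  refine ⟨⟨N - M, by rw [hxy']; push_cast; ring⟩, fun m hm => ?_⟩
  rw [hxy'] at hm
  have hm' : N - M = 2 * m := by
    have : ((N - M : ℤ) : ℝ) = 2 * m := by linarith
    exact_mod_cast this
  have hNM : N ≠ M := by
    rintro rfl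
    exact hxy (by rw [hxr, hys, hrs])
  obtain ⟨u, hu⟩ := hP
  obtain ⟨v, hv⟩ := hQ
  rcases hN with hN | ⟨hN, hN'⟩ | ⟨hN, hN'⟩ <;> rcases hM with hM | ⟨hM, hM'⟩ | ⟨hM, hM'⟩ <;>
    first | omega | linarith

/-- If the translations lie in a class modulo `1 / 2` and the intervals `j`, `k` are aligned with
that class, the grid points and the grid points shifted by `ℓ j` give two tilings of `ℤ`, by `{0, P}`
and by `{0, Q}`. -/
theorem isSpectralSet_of_half_grid (h : IsIntervalTiling o ℓ T)
    (hv : volume (intervalUnion o ℓ) = 1) {i j k : Fin 3}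
    (hij : i ≠ j) (hik : i ≠ k) (hjk : j ≠ k) (hi : ℓ i = 1 / 2) (hjk' : ℓ j + ℓ k = 1 / 2)
    {t₀ : ℝ} (ht₀ : ∀ t ∈ T, ∃ n : ℤ, t = t₀ + n / 2)
    {P Q : ℤ} (hoj : o j = o i + (P : ℝ) / 2) (hok : o k = o i + ℓ j + (Q : ℝ) / 2) :
    IsSpectralSet (intervalUnion o ℓ) := by
  have hj := h.pos j
  have hk := h.pos k
  have hint : ∀ m n : ℤ, (m : ℝ) / 2 ≤ n / 2 → (n : ℝ) / 2 < m / 2 + 1 / 2 → m = n := by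
    intro m n h1 h2
    have h1' : (m : ℝ) ≤ n := by linarith
    have h2' : (n : ℝ) < m + 1 := by linarith
    have h3 : m ≤ n := by exact_mod_cast h1'
    have h4 : n < m + 1 := by exact_mod_cast h2'
    omega
  have hmem1 : ∀ n : ℤ, t₀ + n / 2 ∈ T ∨ t₀ + ((n - P : ℤ) : ℝ) / 2 ∈ T := by
    intro n
    obtain ⟨m, s, hs, hs1, hs2⟩ := h.cover (t₀ + o i + n / 2)
    obtain ⟨n', hn'⟩ := ht₀ _ hs
    rcases Fin.eq_or_eq_or_eq_of_ne hij hik hjk m with rfl | rfl | rfl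
    · left
      have := hint n' n (by linarith) (by linarith)
      rw [← this, ← hn']; exact hs
    · right
      have := hint (n' + P) n (by push_cast; linarith) (by push_cast; linarith)
      rw [← this, add_sub_cancel_right, ← hn']; exact hs
    · exfalso
      have := hint (n' + Q) n (by push_cast; linarith) (by push_cast; linarith)
      rw [← this] at hs1
      push_cast at hs1
      linarith
  have hmem2 : ∀ n : ℤ, t₀ + n / 2 ∈ T ∨ t₀ + ((n - Q : ℤ) : ℝ) / 2 ∈ T := by
    intro n
    obtain ⟨m, s, hs, hs1, hs2⟩ := h.cover (t₀ + o i + n / 2 + ℓ j)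
    obtain ⟨n', hn'⟩ := ht₀ _ hs
    rcases Fin.eq_or_eq_or_eq_of_ne hij hik hjk m with rfl | rfl | rfl
    · left
      have := hint n n' (by
        by_contra hcon
        have h1 : (n' : ℝ) + 1 ≤ n := by
          have : (n' : ℝ) < n := by linarith
          have : n' < n := by exact_mod_cast this
          exact_mod_cast this
        linarith) (by linarith)
      rw [this, ← hn']; exact hs
    · exfalso
      have := hint n (n' + P) (by push_cast; linarith) (by push_cast; linarith)
      rw [this] at hs2
      push_cast at hs2
      linarith
    · right
      have := hint (n' + Q) n (by push_cast; linarith) (by push_cast; linarith)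
      rw [← this, add_sub_cancel_right, ← hn']; exact hs
  have hne1 : ∀ n : ℤ, t₀ + n / 2 ∈ T → t₀ + ((n - P : ℤ) : ℝ) / 2 ∉ T := by
    intro n h1 h2
    refine hij (h.inj (x := t₀ + n / 2 + o i) (by simpa) ?_)
    convert h2 using 1
    rw [hoj]; push_cast; ring
  have hne2 : ∀ n : ℤ, t₀ + n / 2 ∈ T → t₀ + ((n - Q : ℤ) : ℝ) / 2 ∉ T := by
    intro n h1 h2
    have h3 : t₀ + n / 2 + o i + ℓ j - o k ∈ T := by
      convert h2 using 1
      rw [hok]; push_cast; ring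
    exact hik (h.eq_of_mem (x := t₀ + n / 2 + o i + ℓ j) (y := t₀ + n / 2 + o i) (by simpa) h3
      (by linarith) (by linarith) le_rfl (by linarith)).2
  classical
  obtain ⟨d, P', Q', hd, hPd, hQd, hPo, hQo⟩ := exists_odd_of_tiling
    (f := fun n : ℤ => if t₀ + (n : ℝ) / 2 ∈ T then 1 else 0) (P := P) (Q := Q)
    (fun n => by
      by_cases hn : t₀ + (n : ℝ) / 2 ∈ T
      · simp only [hn, hne1 n hn, if_true, if_false, add_zero]
      · simp only [hn, (hmem1 n).resolve_left hn, if_true, if_false, zero_add])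
    (fun n => by
      by_cases hn : t₀ + (n : ℝ) / 2 ∈ T
      · simp only [hne1 n hn, hne2 n hn, if_false]
      · simp only [(hmem1 n).resolve_left hn, (hmem2 n).resolve_left hn, if_true])
  refine isSpectralSet_of_two_sheets hv hij hik hjk hi hjk' hj hk hd hPo hQo ?_ ?_
  · rw [hoj, hPd]; push_cast; ring
  · rw [hok, hQd]; push_cast; ring

end IsIntervalTiling

/-! ### Tilings of the integers by four elements -/

/-- A tiling of `ℤ` by a finite set is periodic: a window as long as the set determines all of
it, and there are finitely many windows. -/
theorem exists_period_of_finset_tiling {f : ℤ → ℤ} (hf : ∀ n, f n = 0 ∨ f n = 1) {F : Finset ℤ}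
    (hF : F.Nonempty) (h : ∀ n, ∑ a ∈ F, f (n - a) = 1) :
    ∃ N : ℕ, 0 < N ∧ Function.Periodic f N := by
  obtain ⟨D, hD⟩ : ∃ D : ℕ, (D : ℤ) = F.max' hF - F.min' hF :=
    ⟨(F.max' hF - F.min' hF).toNat, Int.toNat_of_nonneg
      (sub_nonneg.2 (F.min'_le _ (F.max'_mem hF)))⟩
  have hdet : ∀ g : ℤ → ℤ, (∀ n, ∑ a ∈ F, g (n - a) = 1) → ∀ n : ℤ,
      (∀ x, n ≤ x → x < n + D → f x = g x) → f (n + D) = g (n + D) ∧ f (n - 1) = g (n - 1) := by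
    intro g hg n hn
    constructor
    · have h1 := (h (n + D + F.min' hF)).trans (hg (n + D + F.min' hF)).symm
      rw [← Finset.add_sum_erase _ _ (F.min'_mem hF),
        ← Finset.add_sum_erase _ _ (F.min'_mem hF), add_sub_cancel_right] at h1
      refine add_right_cancel (h1.trans (congrArg _ (Finset.sum_congr rfl fun a ha => ?_)))
      obtain ⟨hne, ha⟩ := Finset.mem_erase.1 ha
      have h2 := F.min'_le a ha
      have h3 := F.le_max' a ha
      exact (hn _ (by omega) (by omega)).symm
    · have h1 := (h (n - 1 + F.max' hF)).trans (hg (n - 1 + F.max' hF)).symm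
      rw [← Finset.add_sum_erase _ _ (F.max'_mem hF),
        ← Finset.add_sum_erase _ _ (F.max'_mem hF), add_sub_cancel_right] at h1
      refine add_right_cancel (h1.trans (congrArg _ (Finset.sum_congr rfl fun a ha => ?_)))
      obtain ⟨hne, ha⟩ := Finset.mem_erase.1 ha
      have h2 := F.min'_le a ha
      have h3 := F.le_max' a ha
      exact (hn _ (by omega) (by omega)).symm
  have hall : ∀ g : ℤ → ℤ, (∀ n, ∑ a ∈ F, g (n - a) = 1) → ∀ n : ℤ,
      (∀ x, n ≤ x → x < n + D → f x = g x) → ∀ x, f x = g x := by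
    intro g hg n hn
    have hwin : ∀ s : ℤ, ∀ x, n + s ≤ x → x < n + s + D → f x = g x := by
      intro s
      induction s using Int.induction_on with
      | zero => simpa using hn
      | succ s ih =>
        intro x h1 h2
        rcases eq_or_ne x (n + s + D) with rfl | hx
        · exact (hdet g hg _ ih).1
        · exact ih x (by omega) (by omega)
      | pred s ih =>
        intro x h1 h2
        rcases eq_or_ne x (n + -s - 1) with rfl | hx
        · exact (hdet g hg _ ih).2
        · exact ih x (by omega) (by omega)
    intro x
    have := (hdet g hg _ (hwin (x + 1 - n))).2
    rwa [show n + (x + 1 - n) - 1 = x by ring] at this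
  obtain ⟨n, n', hnn, heq⟩ := Finite.exists_ne_map_eq_of_infinite
    (fun n : ℕ => fun i : Fin D => decide (f (n + (i : ℕ)) = 1))
  wlog hlt : n < n' generalizing n n'
  · exact this n' n hnn.symm heq.symm (by omega)
  refine ⟨n' - n, by omega, fun x => ?_⟩
  refine (hall (fun x => f (x + ((n' - n : ℕ) : ℤ))) (fun m => ?_) n (fun y h1 h2 => ?_) x).symm
  · rw [← h (m + ((n' - n : ℕ) : ℤ))]
    exact Finset.sum_congr rfl fun a _ => by congr 1; ring
  · have h3 := congrFun heq ⟨(y - n).toNat, by omega⟩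
    simp only [decide_eq_decide] at h3
    rw [show (n : ℤ) + ((y - n).toNat : ℤ) = y by omega,
      show (n' : ℤ) + ((y - n).toNat : ℤ) = y + ((n' - n : ℕ) : ℤ) by omega] at h3
    rcases hf y with h4 | h4 <;> rcases hf (y + ((n' - n : ℕ) : ℤ)) with h5 | h5 <;>
      simp_all

theorem sum_range_add_int_of_periodic {g : ℤ → ℂ} {N : ℕ} (hg : Function.Periodic g N) (s : ℤ) :
    ∑ n ∈ Finset.range N, g (n + s) = ∑ n ∈ Finset.range N, g n := by
  have h1 : ∀ s : ℤ, ∑ n ∈ Finset.range N, g (n + (s + 1)) = ∑ n ∈ Finset.range N, g (n + s) := by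
    intro s
    have h2 := Finset.sum_range_succ (fun n : ℕ => g (n + s)) N
    have h3 := Finset.sum_range_succ' (fun n : ℕ => g (n + s)) N
    rw [h2] at h3
    have h4 : g ((N : ℤ) + s) = g (((0 : ℕ) : ℤ) + s) := by
      rw [add_comm, hg]; simp
    rw [h4] at h3
    rw [add_right_cancel h3]
    refine Finset.sum_congr rfl fun n _ => ?_
    congr 1; push_cast; ring
  induction s using Int.induction_on with
  | zero => simp
  | succ s ih => rw [h1, ih]
  | pred s ih => rw [← ih, ← h1 (-s - 1), sub_add_cancel]

/-- Multiplication of generating polynomials for a periodic tiling, evaluated at an `N`-th root of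
unity. -/
theorem sum_mul_sum_zpow_of_tiling {f : ℤ → ℤ} {F : Finset ℤ}
    (h : ∀ n, ∑ a ∈ F, f (n - a) = 1) {N : ℕ} (hN : Function.Periodic f N) {ζ : ℂ} (hζ0 : ζ ≠ 0)
    (hζ : ζ ^ N = 1) :
    (∑ n ∈ Finset.range N, (f n : ℂ) * ζ ^ n) * ∑ a ∈ F, ζ ^ a = ∑ n ∈ Finset.range N, ζ ^ n := by
  have h1 : ∀ a : ℤ, (∑ n ∈ Finset.range N, (f n : ℂ) * ζ ^ n) * ζ ^ a
      = ∑ n ∈ Finset.range N, (f (n - a) : ℂ) * ζ ^ n := by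
    intro a
    have hper : Function.Periodic (fun n : ℤ => (f (n - a) : ℂ) * ζ ^ n) N := by
      intro n
      simp only
      rw [show n + (N : ℤ) - a = n - a + N by ring, hN, zpow_add₀ hζ0, zpow_natCast, hζ, mul_one]
    have h2 := sum_range_add_int_of_periodic hper a
    simp only [zpow_natCast] at h2
    rw [← h2, Finset.sum_mul]
    refine Finset.sum_congr rfl fun n _ => ?_
    rw [add_sub_cancel_right, zpow_add₀ hζ0, zpow_natCast, mul_assoc]
  rw [Finset.mul_sum]
  simp only [h1]
  rw [Finset.sum_comm]
  refine Finset.sum_congr rfl fun n _ => ?_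
  rw [← Finset.sum_mul]
  have := h n
  have h3 : ((∑ a ∈ F, f (n - a) : ℤ) : ℂ) = 1 := by rw [this]; simp
  push_cast at h3
  rw [h3, one_mul]

theorem Polynomial.isRelPrime_cyclotomic_int {m n : ℕ} (hm : 0 < m) (hn : 0 < n) (hmn : m ≠ n) :
    IsRelPrime (cyclotomic m ℤ) (cyclotomic n ℤ) := by
  rw [(cyclotomic.irreducible hm).isRelPrime_iff_not_dvd]
  intro hdvd
  have hassoc := ((cyclotomic.irreducible hm).dvd_irreducible_iff_associated
    (cyclotomic.irreducible hn)).1 hdvd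
  exact hmn (cyclotomic_injective (eq_of_monic_of_associated (cyclotomic.monic m ℤ)
    (cyclotomic.monic n ℤ) hassoc))

/-- For a four-element set tiling `ℤ`, its generating polynomial vanishes at a primitive root of
unity of order `2 ^ i` with `i ≥ 2`. Otherwise, for a period `N = 2 ^ k M` with `M` odd, the
cyclotomic polynomials of orders `2 ^ 2, ..., 2 ^ k` all divide the polynomial of the translations;
at one this gives `2 ^ (k - 1) ∣ N / 4`. -/
theorem exists_isPrimitiveRoot_sum_zpow_eq_zero {f : ℤ → ℤ} (hf : ∀ n, f n = 0 ∨ f n = 1)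
    {F : Finset ℤ} (hF : F.card = 4) (h : ∀ n, ∑ a ∈ F, f (n - a) = 1) :
    ∃ (m : ℕ) (ζ : ℂ), IsPrimitiveRoot ζ (2 ^ (m + 2)) ∧ ∑ a ∈ F, ζ ^ a = 0 := by
  obtain ⟨N, hN0, hN⟩ := exists_period_of_finset_tiling hf (Finset.card_pos.1 (by omega)) h
  obtain ⟨k, M, hM, hNk⟩ := Nat.exists_eq_two_pow_mul_odd hN0.ne'
  by_contra hcon
  push Not at hcon
  set p : Polynomial ℤ := ∑ n ∈ Finset.range N, Polynomial.C (f n) * Polynomial.X ^ n with hp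
  have hdvd : ∀ i ∈ Finset.Icc 2 k, Polynomial.cyclotomic (2 ^ i) ℤ ∣ p := by
    intro i hi
    rw [Finset.mem_Icc] at hi
    have hprim := Complex.isPrimitiveRoot_exp (2 ^ i) (by positivity)
    set ζ := Complex.exp (2 * Real.pi * Complex.I / ((2 ^ i : ℕ) : ℂ)) with hζ
    rw [Polynomial.cyclotomic_eq_minpoly hprim (by positivity)]
    refine minpoly.isIntegrallyClosed_dvd (hprim.isIntegral (by positivity)) ?_
    have hζN : ζ ^ N = 1 := by
      rw [hprim.pow_eq_one_iff_dvd, hNk]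
      exact (pow_dvd_pow 2 hi.2).trans (dvd_mul_right _ _)
    have hne1 : ζ ≠ 1 := hprim.ne_one (Nat.one_lt_two_pow (by omega))
    have hmul := sum_mul_sum_zpow_of_tiling h hN (hprim.ne_zero (by positivity)) hζN
    rw [geom_sum_eq hne1, hζN, sub_self, zero_div] at hmul
    have hne := hcon (i - 2) ζ (by rwa [Nat.sub_add_cancel hi.1])
    have h0 := (mul_eq_zero.1 hmul).resolve_right hne
    rw [hp, map_sum, ← h0]
    exact Finset.sum_congr rfl fun n _ => by simp
  have hprod : ∏ i ∈ Finset.Icc 2 k, Polynomial.cyclotomic (2 ^ i) ℤ ∣ p := by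
    refine Finset.prod_dvd_of_isRelPrime (fun i _ j _ hij => ?_) hdvd
    exact Polynomial.isRelPrime_cyclotomic_int (by positivity) (by positivity)
      fun hc => hij (Nat.pow_right_injective le_rfl hc)
  have heval := Polynomial.eval_dvd (x := 1) hprod
  have hfac : ∀ i ∈ Finset.Icc 2 k, (Polynomial.cyclotomic (2 ^ i) ℤ).eval 1 = 2 := by
    intro i hi
    rw [Finset.mem_Icc] at hi
    obtain ⟨i', rfl⟩ := Nat.exists_eq_add_of_le' (show 1 ≤ i by omega)
    have : Fact (Nat.Prime 2) := ⟨Nat.prime_two⟩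
    exact_mod_cast Polynomial.eval_one_cyclotomic_prime_pow (R := ℤ) (p := 2) i'
  rw [Polynomial.eval_prod, Finset.prod_congr rfl hfac, Finset.prod_const, Nat.card_Icc] at heval
  have hcount : 4 * p.eval 1 = N := by
    have h1 := sum_mul_sum_zpow_of_tiling h hN (ζ := 1) one_ne_zero (one_pow _)
    simp only [one_zpow, one_pow, mul_one, Finset.sum_const, Finset.card_range, hF,
      nsmul_eq_mul] at h1
    have h2 : p.eval 1 = ∑ n ∈ Finset.range N, f n := by
      rw [hp, Polynomial.eval_finsetSum]
      simp
    rw [h2]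
    have h3 : ((4 * ∑ n ∈ Finset.range N, f n : ℤ) : ℂ) = ((N : ℤ) : ℂ) := by
      push_cast at h1 ⊢
      rw [← h1]; ring
    exact_mod_cast h3
  obtain ⟨c, hc⟩ := heval
  obtain ⟨v, hv⟩ := hM
  rcases Nat.eq_zero_or_pos k with rfl | hk
  · rw [pow_zero, one_mul] at hNk
    omega
  · obtain ⟨k', rfl⟩ := Nat.exists_eq_add_of_le' hk
    rw [show k' + 1 + 1 - 2 = k' by omega] at hc
    have h1 : (2 : ℤ) ^ k' * (4 * c) = 2 ^ k' * (2 * (2 * v + 1)) := by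
      have : (N : ℤ) = 2 ^ (k' + 1) * (2 * v + 1) := by rw [hNk, hv]; push_cast; ring
      rw [hc, this] at hcount
      linear_combination hcount
    have h2 := mul_left_cancel₀ (by positivity) h1
    omega

theorem IsPrimitiveRoot.exists_odd_of_zpow_eq_neg_one {ζ : ℂ} {m : ℕ}
    (hζ : IsPrimitiveRoot ζ (2 ^ (m + 2))) {P : ℤ} (hP : ζ ^ P = -1) :
    ∃ u : ℤ, Odd u ∧ P = 2 ^ (m + 1) * u := by
  have h1 : ζ ^ (P * 2) = 1 := by rw [zpow_mul, hP]; norm_num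
  rw [hζ.zpow_eq_one_iff_dvd] at h1
  obtain ⟨u, hu⟩ := h1
  have hPu : P = 2 ^ (m + 1) * u := by
    push_cast at hu
    have : P * 2 = (2 ^ (m + 1) * u) * 2 := by rw [hu]; ring
    linarith
  refine ⟨u, ?_, hPu⟩
  by_contra hodd
  rw [Int.not_odd_iff_even] at hodd
  obtain ⟨w, rfl⟩ := hodd
  have : ζ ^ P = 1 := by
    rw [hζ.zpow_eq_one_iff_dvd]
    exact ⟨w, by rw [hPu]; push_cast; ring⟩
  rw [hP] at this
  norm_num at this

/-- If `1 + u + v + w = 0` with `u`, `v`, `w` on the unit circle, then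
`(1 + u) (1 + v) (1 + w) = 0`: the four numbers form two opposite pairs. -/
theorem exists_odd_of_sum_zpow_eq_zero {ζ : ℂ} {m : ℕ} (hζ : IsPrimitiveRoot ζ (2 ^ (m + 2)))
    {P Q : ℤ} (h : 1 + ζ + ζ ^ P + ζ ^ Q = 0) :
    ∃ u v : ℤ, Odd u ∧ Odd v ∧ ((P = 2 ^ (m + 1) * u ∧ Q - 1 = 2 ^ (m + 1) * v) ∨
      (Q = 2 ^ (m + 1) * u ∧ P - 1 = 2 ^ (m + 1) * v)) := by
  have h0 : ζ ≠ 0 := hζ.ne_zero (by positivity)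
  have hconj : (starRingEnd ℂ) ζ = ζ⁻¹ :=
    (Complex.inv_eq_conj (hζ.norm'_eq_one (by positivity))).symm
  have hc := congrArg (starRingEnd ℂ) h
  simp only [map_add, map_one, map_zpow₀, hconj, map_zero, inv_zpow] at hc
  have hP0 : ζ ^ P ≠ 0 := zpow_ne_zero _ h0
  have hQ0 : ζ ^ Q ≠ 0 := zpow_ne_zero _ h0
  have h2 : ζ * ζ ^ P * ζ ^ Q + ζ ^ P * ζ ^ Q + ζ * ζ ^ Q + ζ * ζ ^ P = 0 := by
    field_simp at hc
    linear_combination hc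
  have h3 : (1 + ζ) * (1 + ζ ^ P) * (1 + ζ ^ Q) = 0 := by linear_combination h + h2
  have h4 : 1 + ζ ≠ 0 := by
    intro h5
    have h6 : ζ ^ 2 = 1 := by
      rw [show ζ = -1 by linear_combination h5]; norm_num
    rw [hζ.pow_eq_one_iff_dvd] at h6
    have h7 := Nat.le_of_dvd (by norm_num) h6
    have h8 : 2 ^ 2 ≤ 2 ^ (m + 2) := Nat.pow_le_pow_right (by norm_num) (by omega)
    omega
  have hsub : ∀ R : ℤ, ζ + ζ ^ R = 0 → ζ ^ (R - 1) = -1 := by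
    intro R hR
    rw [zpow_sub_one₀ h0, show ζ ^ R = -ζ by linear_combination hR]
    field_simp
  rcases mul_eq_zero.1 h3 with h5 | h5
  · have h6 := (mul_eq_zero.1 h5).resolve_left h4
    obtain ⟨u, hu, hPu⟩ := hζ.exists_odd_of_zpow_eq_neg_one (P := P) (by linear_combination h6)
    obtain ⟨v, hv, hQv⟩ := hζ.exists_odd_of_zpow_eq_neg_one (hsub Q (by linear_combination h - h6))
    exact ⟨u, v, hu, hv, Or.inl ⟨hPu, hQv⟩⟩
  · obtain ⟨u, hu, hPu⟩ := hζ.exists_odd_of_zpow_eq_neg_one (P := Q) (by linear_combination h5)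
    obtain ⟨v, hv, hQv⟩ := hζ.exists_odd_of_zpow_eq_neg_one (hsub P (by linear_combination h - h5))
    exact ⟨u, v, hu, hv, Or.inr ⟨hPu, hQv⟩⟩

/-- A tiling of `ℤ` by `{0, 1, P, Q}` pairs `0` with the even one among `P` and `Q` and `1` with
the odd one, and the differences in both pairs have the same positive two-adic valuation. -/
theorem exists_odd_of_quadruple_tiling {f : ℤ → ℤ} (hf : ∀ n, f n = 0 ∨ f n = 1) {P Q : ℤ}
    (h : ∀ n, f n + f (n - 1) + f (n - P) + f (n - Q) = 1) :
    ∃ (m : ℕ) (u v : ℤ), Odd u ∧ Odd v ∧ ((P = 2 ^ (m + 1) * u ∧ Q - 1 = 2 ^ (m + 1) * v) ∨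
      (Q = 2 ^ (m + 1) * u ∧ P - 1 = 2 ^ (m + 1) * v)) := by
  have hex : ∃ n, f n = 1 := by
    by_contra hcon
    push Not at hcon
    have h0 : ∀ n, f n = 0 := fun n => (hf n).resolve_right (hcon n)
    have := h 0
    simp [h0] at this
  obtain ⟨n, hn⟩ := hex
  have hnn : ∀ n, 0 ≤ f n := fun n => by rcases hf n with h | h <;> omega
  have hP0 : P ≠ 0 := by
    rintro rfl
    have := h n
    rw [sub_zero] at this
    linarith [hnn (n - 1), hnn (n - Q)]
  have hQ0 : Q ≠ 0 := by
    rintro rfl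
    have := h n
    rw [sub_zero] at this
    linarith [hnn (n - 1), hnn (n - P)]
  have hP1 : P ≠ 1 := by
    rintro rfl
    have := h (n + 1)
    rw [add_sub_cancel_right] at this
    linarith [hnn (n + 1), hnn (n + 1 - Q)]
  have hQ1 : Q ≠ 1 := by
    rintro rfl
    have := h (n + 1)
    rw [add_sub_cancel_right] at this
    linarith [hnn (n + 1), hnn (n + 1 - P)]
  have hPQ : P ≠ Q := by
    rintro rfl
    have := h (n + P)
    rw [add_sub_cancel_right] at this
    linarith [hnn (n + P), hnn (n + P - 1)]
  have hsum : ∀ {E : Type} [AddCommMonoid E] (g : ℤ → E), ∑ a ∈ ({0, 1, P, Q} : Finset ℤ), g a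
      = g 0 + (g 1 + (g P + g Q)) := by
    intro E _ g
    rw [Finset.sum_insert, Finset.sum_insert, Finset.sum_insert, Finset.sum_singleton]
    · simpa using hPQ
    · simp [hP1.symm, hQ1.symm]
    · simp [hP0.symm, hQ0.symm]
  obtain ⟨m, ζ, hζ, hζ0⟩ := exists_isPrimitiveRoot_sum_zpow_eq_zero hf (F := {0, 1, P, Q})
    (by
      rw [Finset.card_insert_of_notMem, Finset.card_insert_of_notMem, Finset.card_pair hPQ]
      · simp [hP1.symm, hQ1.symm]
      · simp [hP0.symm, hQ0.symm])
    (fun n => by rw [hsum, sub_zero]; linarith [h n])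
  rw [hsum, zpow_zero, zpow_one] at hζ0
  obtain ⟨u, v, huv⟩ := exists_odd_of_sum_zpow_eq_zero hζ (P := P) (Q := Q)
    (by rw [← hζ0]; ring)
  exact ⟨m, u, v, huv⟩

namespace IsIntervalTiling

variable {o ℓ : Fin 3 → ℝ} {T : Set ℝ}

/-- Lengths `1 / 2`, `1 / 4`, `1 / 4`: the endpoints lie on a grid of step `1 / 4`, and the long
interval counts as two cells. -/
theorem isSpectralSet_of_length_eq_quarter (h : IsIntervalTiling o ℓ T)
    (hv : volume (intervalUnion o ℓ) = 1) {i j k : Fin 3} (hij : i ≠ j) (hik : i ≠ k) (hjk : j ≠ k)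
    (hi : ℓ i = 1 / 2) (hj : ℓ j = 1 / 4) (hk : ℓ k = 1 / 4) :
    IsSpectralSet (intervalUnion o ℓ) := by
  obtain ⟨t₀, ht₀⟩ := h.nonempty
  have hcases := Fin.eq_or_eq_or_eq_of_ne hij hik hjk
  have hgrid : ∀ n : ℤ, (∃ m, t₀ + o i + n / 4 - o m ∈ T) ∨ t₀ + (n - 1) / 4 ∈ T := by
    intro n
    induction n using Int.induction_on with
    | zero => exact Or.inl ⟨i, by simpa using ht₀⟩
    | succ n ih =>
      rcases ih with ⟨m, hm⟩ | hm
      · rcases hcases m with rfl | rfl | rfl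
        · right; convert hm using 1; push_cast; ring
        · obtain ⟨p, hp⟩ := h.next hm
          left; refine ⟨p, ?_⟩; convert hp using 1; rw [hj]; push_cast; ring
        · obtain ⟨p, hp⟩ := h.next hm
          left; refine ⟨p, ?_⟩; convert hp using 1; rw [hk]; push_cast; ring
      · have hm' : t₀ + o i + (n - 1) / 4 - o i ∈ T := by convert hm using 1; push_cast; ring
        obtain ⟨p, hp⟩ := h.next hm'
        left; refine ⟨p, ?_⟩; convert hp using 1; rw [hi]; push_cast; ring
    | pred n ih =>
      rcases ih with ⟨m, hm⟩ | hm
      · obtain ⟨p, hp⟩ := h.prev hm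
        rcases hcases p with rfl | rfl | rfl
        · right; convert hp using 1; rw [hi]; push_cast; ring
        · left; refine ⟨p, ?_⟩; convert hp using 1; rw [hj]; push_cast; ring
        · left; refine ⟨p, ?_⟩; convert hp using 1; rw [hk]; push_cast; ring
      · left; refine ⟨i, ?_⟩; convert hm using 1; push_cast; ring
  have hall : ∀ m y, y - o m ∈ T → ∃ n : ℤ, y = t₀ + o i + n / 4 := by
    intro m y hy
    refine ⟨⌊4 * (y - (t₀ + o i))⌋, ?_⟩
    have h1 := Int.floor_le (4 * (y - (t₀ + o i)))
    have h2 := Int.lt_floor_add_one (4 * (y - (t₀ + o i)))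
    rcases hgrid ⌊4 * (y - (t₀ + o i))⌋ with ⟨p, hp⟩ | hp
    · have hp4 : 1 / 4 ≤ ℓ p := by
        rcases hcases p with rfl | rfl | rfl <;> linarith
      exact (h.eq_of_mem hy hp le_rfl (by linarith [h.pos m]) (by linarith) (by linarith)).1
    · exfalso
      have := (h.eq_of_mem (j := i) (z := t₀ + o i + (⌊4 * (y - (t₀ + o i))⌋ - 1) / 4) hy
        (by convert hp using 1; ring) le_rfl (by linarith [h.pos m]) (by linarith)
        (by linarith)).1
      linarith
  obtain ⟨P, hP⟩ := hall j (t₀ + o j) (by simpa)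
  obtain ⟨Q, hQ⟩ := hall k (t₀ + o k) (by simpa)
  classical
  obtain ⟨m, u, v, hu, hv', hPQ⟩ := exists_odd_of_quadruple_tiling
    (f := fun n : ℤ => if t₀ + (n : ℝ) / 4 ∈ T then 1 else 0) (P := P) (Q := Q)
    (fun n => by by_cases hn : t₀ + (n : ℝ) / 4 ∈ T <;> simp [hn]) (fun n => by
      obtain ⟨x, hx⟩ : ∃ x, x = t₀ + o i + (n : ℝ) / 4 := ⟨_, rfl⟩
      obtain ⟨x', hx'⟩ : ∃ x', x' = x - 1 / 4 := ⟨_, rfl⟩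
      have e0 : t₀ + (n : ℝ) / 4 = x - o i := by linarith
      have e1 : t₀ + ((n - 1 : ℤ) : ℝ) / 4 = x' - o i := by push_cast; linarith
      have e2 : t₀ + ((n - P : ℤ) : ℝ) / 4 = x - o j := by push_cast; linarith
      have e3 : t₀ + ((n - Q : ℤ) : ℝ) / 4 = x - o k := by push_cast; linarith
      simp only [e0, e1, e2, e3]
      have hne : ∀ p q, p ≠ q → x - o p ∈ T → x - o q ∉ T := fun p q hpq hp hq => hpq (h.inj hp hq)
      have hne' : ∀ p, x - o p ∈ T → x' - o i ∉ T := fun p hp hq => by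
        have := (h.eq_of_mem (x := x) hp hq le_rfl (by linarith [h.pos p]) (by linarith)
          (by linarith)).1
        linarith
      rcases hgrid n with ⟨p, hp⟩ | hp
      · rw [← hx] at hp
        rcases hcases p with rfl | rfl | rfl
        · simp [hp, hne _ _ hij hp, hne _ _ hik hp, hne' _ hp]
        · simp [hp, hne _ _ hij.symm hp, hne _ _ hjk hp, hne' _ hp]
        · simp [hp, hne _ _ hik.symm hp, hne _ _ hjk.symm hp, hne' _ hp]
      · rw [show t₀ + ((n : ℝ) - 1) / 4 = x' - o i by linarith] at hp
        have h0 : ∀ p, x - o p ∉ T := fun p hq => hne' p hq hp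
        simp [hp, h0])
  have hd : ((2 : ℤ) ^ m) ≠ 0 := by positivity
  rcases hPQ with ⟨hP', hQ'⟩ | ⟨hQ', hP'⟩
  · have hPR : (P : ℝ) = 2 ^ (m + 1) * u := by exact_mod_cast hP'
    have hQR : (Q : ℝ) - 1 = 2 ^ (m + 1) * v := by exact_mod_cast hQ'
    rw [pow_succ] at hPR hQR
    refine isSpectralSet_of_two_sheets hv hij hik hjk hi (by linarith) (h.pos j) (h.pos k) hd hu hv'
      ?_ ?_
    · push_cast; linarith
    · push_cast; linarith
  · have hQR : (Q : ℝ) = 2 ^ (m + 1) * u := by exact_mod_cast hQ'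
    have hPR : (P : ℝ) - 1 = 2 ^ (m + 1) * v := by exact_mod_cast hP'
    rw [pow_succ] at hPR hQR
    refine isSpectralSet_of_two_sheets hv hik hij hjk.symm hi (by linarith) (h.pos k) (h.pos j) hd
      hu hv' ?_ ?_
    · push_cast; linarith
    · push_cast; linarith

end IsIntervalTiling

/-! ### Enumeration of runs and the recurrence of their lengths -/

theorem exists_strictMono_int_range_eq {R : Set ℝ} (hfin : ∀ a b, (R ∩ Set.Icc a b).Finite)
    (hup : ∀ x, ∃ y ∈ R, x < y) (hdown : ∀ x, ∃ y ∈ R, y < x) :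
    ∃ ρ : ℤ → ℝ, StrictMono ρ ∧ Set.range ρ = R := by
  let _ : LocallyFiniteOrder R := LocallyFiniteOrder.ofFiniteIcc fun a b => by
    refine Set.Finite.of_finite_image (f := Subtype.val) ((hfin a b).subset ?_)
      Subtype.val_injective.injOn
    rintro _ ⟨x, hx, rfl⟩
    exact ⟨x.2, hx⟩
  let _ : SuccOrder R := LinearLocallyFiniteOrder.succOrder R
  let _ : PredOrder R := LinearLocallyFiniteOrder.predOrder R
  have : NoMaxOrder R := ⟨fun a => by
    obtain ⟨y, hy, h⟩ := hup a
    exact ⟨⟨y, hy⟩, h⟩⟩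
  have : NoMinOrder R := ⟨fun a => by
    obtain ⟨y, hy, h⟩ := hdown a
    exact ⟨⟨y, hy⟩, h⟩⟩
  have : Nonempty R := by
    obtain ⟨y, hy, -⟩ := hup 0
    exact ⟨⟨y, hy⟩⟩
  let e := (orderIsoIntOfLinearSuccPredArch (ι := R)).symm
  refine ⟨fun n => e n, fun m n hmn => e.strictMono hmn, ?_⟩
  ext x
  constructor
  · rintro ⟨n, rfl⟩; exact (e n).2
  · intro hx
    exact ⟨e.symm ⟨x, hx⟩, by simp⟩

/-- The numbers `t, t + 1 / 2, ..., t + (r - 1) / 2` form a maximal arithmetic progression of step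
`1 / 2` in `T`. For an interval of length `1 / 2` it corresponds to a maximal block of repeated
letters. -/
structure IsRun (T : Set ℝ) (t : ℝ) (r : ℕ) : Prop where
  pos : 0 < r
  sub_notMem : t - 1 / 2 ∉ T
  mem : ∀ c < r, t + (c : ℝ) / 2 ∈ T
  end_notMem : t + (r : ℝ) / 2 ∉ T

theorem IsRun.left_mem {T : Set ℝ} {t : ℝ} {r : ℕ} (h : IsRun T t r) : t ∈ T := by
  simpa using h.mem 0 h.pos

theorem IsRun.eq {T : Set ℝ} {t : ℝ} {r s : ℕ} (hr : IsRun T t r) (hs : IsRun T t s) : r = s := by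
  rcases lt_trichotomy r s with h | h | h
  · exact absurd (hs.mem r h) hr.end_notMem
  · exact h
  · exact absurd (hr.mem s h) hs.end_notMem

theorem eq_add_of_mem_run {T : Set ℝ} (hT : ∀ s ∈ T, ∀ t ∈ T, s < t → s + 1 / 2 ≤ t) {ρ s : ℝ}
    {k : ℕ} (hρ : ∀ c ≤ k, ρ + (c : ℝ) / 2 ∈ T) (hs : s ∈ T) (h1 : ρ ≤ s) (h2 : s ≤ ρ + (k : ℝ) / 2) :
    ∃ c ≤ k, s = ρ + (c : ℝ) / 2 := by
  have h0 : 0 ≤ 2 * (s - ρ) := by linarith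
  have hc1 := Nat.floor_le h0
  have hc2 := Nat.lt_floor_add_one (2 * (s - ρ))
  have hck : ⌊2 * (s - ρ)⌋₊ ≤ k := by
    have : ((⌊2 * (s - ρ)⌋₊ : ℕ) : ℝ) ≤ k := by linarith
    exact_mod_cast this
  refine ⟨_, hck, ?_⟩
  by_contra hne
  have := hT _ (hρ _ hck) s hs (lt_of_le_of_ne (by linarith) (Ne.symm hne))
  linarith

/-- The rigidity of the sequence of runs. Here `ρ n` and `r n` are the starts and the lengths of
the runs, and the word after the run `n` alternates between the short letters, of lengths `b` and
`c`, coming from the runs `n + f` and `n + g`; `σ n` and `τ n` tell whether the word begins,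
respectively ends, with the letter of length `c`. The difference `d n = r (n + f) - r (n + g)` is
`1 - σ n - τ n`. As neither `2 b` nor `2 c` is a multiple of `1 / 2`, comparison of gaps gives
`d (n + f) = d (n + g) = 1 - τ n - σ (n + 1)` and `r (n + 2 f) = r (n + 1) = r (n + 2 g)`. Then
`d (n + f) + d (n + g) = r (n + 2 f) - r (n + 2 g) = 0`, so that `d = 0`, and each word consists of
pairs of short letters, of total length `1 / 2`. -/
theorem run_recurrence_rigid {ρ : ℤ → ℝ} {r σ τ : ℤ → ℤ} {p q b c : ℝ} {f g : ℤ}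
    (hb : 0 < b) (hc : 0 < c) (hbc : b + c = 1 / 2) (hne : b ≠ c)
    (hσ : ∀ n, σ n = 0 ∨ σ n = 1) (hτ : ∀ n, τ n = 0 ∨ τ n = 1)
    (h1 : ∀ n, ρ (n + f) + p = ρ n + r n / 2 + σ n * c)
    (h2 : ∀ n, ρ (n + g) + q = ρ n + r n / 2 + (1 - σ n) * b)
    (h3 : ∀ n, ρ (n + f) + p + (r (n + f) - 1) / 2 + b = ρ (n + 1) - τ n * c)
    (h4 : ∀ n, ρ (n + g) + q + (r (n + g) - 1) / 2 + c = ρ (n + 1) - (1 - τ n) * b) :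
    ∀ n, ∃ N : ℤ, ρ n = ρ 0 + N / 2 := by
  have hzero : ∀ {x : ℝ} {K M : ℤ}, 0 < x → x < 1 / 2 → x ≠ 1 / 4 → -2 ≤ K → K ≤ 2 →
      (M : ℝ) / 2 = K * x → K = 0 ∧ M = 0 := by
    intro x K M hx0 hx1 hx2 hK1 hK2 hM
    have hint : ∀ y : ℝ, 0 < y → y < 1 → ∀ m : ℤ, (m : ℝ) = y → False := by
      intro y hy0 hy1 m hm
      have h1 : (0 : ℝ) < m := by linarith
      have h2 : (m : ℝ) < 1 := by linarith
      have h1' : 0 < m := by exact_mod_cast h1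
      have h2' : m < 1 := by exact_mod_cast h2
      omega
    have hint2 : ∀ m : ℤ, (m : ℝ) = 4 * x → False := by
      intro m hm
      have h1 : (0 : ℝ) < m := by linarith
      have h2 : (m : ℝ) < 2 := by linarith
      have h1' : 0 < m := by exact_mod_cast h1
      have h2' : m < 2 := by exact_mod_cast h2
      obtain rfl : m = 1 := by omega
      push_cast at hm
      exact hx2 (by linarith)
    have hK : K = -2 ∨ K = -1 ∨ K = 0 ∨ K = 1 ∨ K = 2 := by omega
    rcases hK with rfl | rfl | rfl | rfl | rfl
    · exact (hint2 (-M) (by push_cast at hM ⊢; linarith)).elim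
    · exact (hint (2 * x) (by linarith) (by linarith) (-M) (by push_cast at hM ⊢; linarith)).elim
    · refine ⟨rfl, ?_⟩
      have : (M : ℝ) = 0 := by push_cast at hM; linarith
      exact_mod_cast this
    · exact (hint (2 * x) (by linarith) (by linarith) M (by push_cast at hM ⊢; linarith)).elim
    · exact (hint2 M (by push_cast at hM ⊢; linarith)).elim
  have hc4 : c ≠ 1 / 4 := fun h => hne (by linarith)
  have hb4 : b ≠ 1 / 4 := fun h => hne (by linarith)
  have hb' : b = 1 / 2 - c := by linarith
  -- the length of the word, from its copies of either short letter
  have hd : ∀ n, r (n + f) - r (n + g) = 1 - σ n - τ n := by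
    intro n
    have e : ((r (n + f) : ℝ) - r (n + g)) = 1 - σ n - τ n := by
      have a1 := h1 n; have a2 := h2 n; have a3 := h3 n; have a4 := h4 n
      rw [hb'] at a2 a3 a4
      linear_combination 2 * a3 - 2 * a4 - 2 * a1 + 2 * a2
    exact_mod_cast e
  have hf : ∀ n, r (n + f + f) - r (n + 1) = 0 ∧ τ n + σ (n + 1) - 1 + (1 - σ (n + f) - τ (n + f)) = 0
      := by
    intro n
    have e : (((r (n + f + f) - r (n + 1) : ℤ)) : ℝ) / 2
        = ((τ n + σ (n + 1) - 1 + (1 - σ (n + f) - τ (n + f)) : ℤ) : ℝ) * c := by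
      have a1 := h1 (n + 1); have a3 := h3 n; have a1' := h1 (n + f); have a3' := h3 (n + f)
      rw [show n + 1 + f = n + f + 1 by ring] at a1
      push_cast
      linear_combination a3' - a1' + a1 - a3
    have hs1 := hσ (n + 1); have hs2 := hσ (n + f); have ht1 := hτ n; have ht2 := hτ (n + f)
    exact (hzero hc (by linarith) hc4 (by omega) (by omega) e).symm
  have hg : ∀ n, r (n + g + g) - r (n + 1) = 0 ∧
      1 - τ n - σ (n + 1) - (1 - σ (n + g) - τ (n + g)) = 0 := by
    intro n
    have e : (((r (n + g + g) - r (n + 1) : ℤ)) : ℝ) / 2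
        = ((1 - τ n - σ (n + 1) - (1 - σ (n + g) - τ (n + g)) : ℤ) : ℝ) * b := by
      have a1 := h2 (n + 1); have a3 := h4 n; have a1' := h2 (n + g); have a3' := h4 (n + g)
      rw [show n + 1 + g = n + g + 1 by ring] at a1
      push_cast
      linear_combination a3' - a1' + a1 - a3
    have hs1 := hσ (n + 1); have hs2 := hσ (n + g); have ht1 := hτ n; have ht2 := hτ (n + g)
    exact (hzero hb (by linarith) hb4 (by omega) (by omega) e).symm
  have hstep : ∀ n, 1 - τ n - σ (n + 1) = 0 := by
    intro n
    have d1 := hd (n + f)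
    have d2 := hd (n + g)
    rw [show n + g + f = n + f + g by ring] at d2
    have f1 := hf n
    have g1 := hg n
    omega
  have hd0 : ∀ n, 1 - σ n - τ n = 0 := by
    intro n
    have f1 := hf (n - f)
    have s1 := hstep (n - f)
    rw [sub_add_cancel] at f1
    omega
  intro n
  have hgap : ∀ n, ρ (n + 1) = ρ n + ((r n + r (n + f) : ℤ) : ℝ) / 2 := by
    intro n
    have a1 := h1 n
    have a3 := h3 n
    have : (1 - σ n - τ n : ℝ) = 0 := by exact_mod_cast hd0 n
    push_cast
    linear_combination a1 - a3 - c * this + hbc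
  induction n using Int.induction_on with
  | zero => exact ⟨0, by simp⟩
  | succ n ih =>
    obtain ⟨N, hN⟩ := ih
    exact ⟨N + (r n + r (n + f)), by rw [hgap, hN]; push_cast; ring⟩
  | pred n ih =>
    obtain ⟨N, hN⟩ := ih
    have := hgap (-n - 1)
    rw [sub_add_cancel, hN] at this
    exact ⟨N - (r (-n - 1) + r (-n - 1 + f)), by push_cast at this ⊢; linarith⟩

/-! ### The word after a run -/

namespace IsIntervalTiling

variable {o ℓ : Fin 3 → ℝ} {T : Set ℝ}

theorem not_forall_add_half_mem (h : IsIntervalTiling o ℓ T) {i j : Fin 3} (hij : i ≠ j)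
    (hi : ℓ i = 1 / 2) (t : ℝ) : ¬ ∀ c : ℕ, t + (c : ℝ) / 2 ∈ T := by
  intro hall
  obtain ⟨N, hN⟩ := exists_nat_ge (2 * (o i - o j))
  have h0 : 0 ≤ 2 * ((N : ℝ) / 2 + o j - o i) := by linarith
  have h1 := Nat.floor_le h0
  have h2 := Nat.lt_floor_add_one (2 * ((N : ℝ) / 2 + o j - o i))
  refine hij (h.eq_of_mem (x := t + (N : ℝ) / 2 + o j)
    (y := t + (⌊2 * ((N : ℝ) / 2 + o j - o i)⌋₊ : ℝ) / 2 + o i) (z := t + (N : ℝ) / 2 + o j)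
    ?_ ?_ (by linarith) (by linarith) le_rfl (by linarith [h.pos j])).2
  · rw [add_sub_cancel_right]; exact hall _
  · rw [add_sub_cancel_right]; exact hall _

theorem not_forall_sub_half_mem (h : IsIntervalTiling o ℓ T) {i j : Fin 3} (hij : i ≠ j)
    (hi : ℓ i = 1 / 2) (t : ℝ) : ¬ ∀ c : ℕ, t - (c : ℝ) / 2 ∈ T := by
  intro hall
  obtain ⟨N, hN⟩ := exists_nat_ge (2 * (o j - o i))
  have h0 : 0 ≤ 2 * ((N : ℝ) / 2 - o j + o i) := by linarith
  have h1 := Nat.ceil_lt_add_one h0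
  have h2 := Nat.le_ceil (2 * ((N : ℝ) / 2 - o j + o i))
  refine hij (h.eq_of_mem (x := t - (N : ℝ) / 2 + o j)
    (y := t - (⌈2 * ((N : ℝ) / 2 - o j + o i)⌉₊ : ℝ) / 2 + o i) (z := t - (N : ℝ) / 2 + o j)
    ?_ ?_ (by linarith) (by linarith) le_rfl (by linarith [h.pos j])).2
  · rw [add_sub_cancel_right]; exact hall _
  · rw [add_sub_cancel_right]; exact hall _

theorem half_separated (h : IsIntervalTiling o ℓ T) {i : Fin 3} (hi : ℓ i = 1 / 2) :
    ∀ s ∈ T, ∀ t ∈ T, s < t → s + 1 / 2 ≤ t := fun s hs t ht hst => by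
  have := h.separated i hs ht hst
  linarith

theorem exists_isRun (h : IsIntervalTiling o ℓ T) {i j : Fin 3} (hij : i ≠ j)
    (hi : ℓ i = 1 / 2) {t : ℝ} (ht : t ∈ T) (ht' : t - 1 / 2 ∉ T) : ∃ r, IsRun T t r := by
  classical
  have hex := h.not_forall_add_half_mem hij hi t
  push Not at hex
  refine ⟨Nat.find hex, ?_, ht', fun c hc => ?_, Nat.find_spec hex⟩
  · rw [Nat.find_pos]
    simpa using ht
  · simpa using Nat.find_min hex hc

theorem exists_run_start (h : IsIntervalTiling o ℓ T) {i j : Fin 3} (hij : i ≠ j)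
    (hi : ℓ i = 1 / 2) {t : ℝ} (ht : t ∈ T) :
    ∃ (ρ : ℝ) (k : ℕ), ρ - 1 / 2 ∉ T ∧ t = ρ + (k : ℝ) / 2 ∧ ∀ c ≤ k, ρ + (c : ℝ) / 2 ∈ T := by
  classical
  have hex := h.not_forall_sub_half_mem hij hi t
  push Not at hex
  have hpos : 0 < Nat.find hex := by
    rw [Nat.find_pos]
    simpa using ht
  obtain ⟨k, hk⟩ := Nat.exists_eq_add_of_le' hpos
  refine ⟨t - (k : ℝ) / 2, k, ?_, by ring, fun c hc => ?_⟩
  · have := Nat.find_spec hex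
    rw [hk] at this
    have e : t - (k : ℝ) / 2 - 1 / 2 = t - ((k + 1 : ℕ) : ℝ) / 2 := by push_cast; ring
    rwa [e]
  · have := Nat.find_min hex (m := k - c) (by omega)
    rw [not_not] at this
    have e : t - (k : ℝ) / 2 + (c : ℝ) / 2 = t - ((k - c : ℕ) : ℝ) / 2 := by
      rw [Nat.cast_sub hc]; ring
    rwa [e]

/-- The word between two consecutive blocks of the long letter does not consist of one short
letter. -/
theorem notMem_of_single (h : IsIntervalTiling o ℓ T) {i j k : Fin 3} (hij : i ≠ j)
    (hik : i ≠ k) (hjk : j ≠ k) (hi : ℓ i = 1 / 2) (hs : ℓ j + ℓ k = 1 / 2) (hne : ℓ j ≠ ℓ k)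
    {t : ℝ} (ht : t ∈ T) : t + 1 / 2 + ℓ j ∉ T := by
  intro ht'
  have hj := h.pos j
  have hk := h.pos k
  have hsep := h.half_separated hi
  have hcons : ∀ u ∈ T, t < u → ¬ u < t + 1 / 2 + ℓ j := fun u hu h1 h2 => by
    have := hsep t ht u hu h1
    have := hsep u hu _ ht' h2
    linarith
  obtain ⟨y, hy⟩ : ∃ y, y = t + o k := ⟨_, rfl⟩
  have hy1 : y - o k ∈ T := by rwa [hy, add_sub_cancel_right]
  have hy2 : y + 1 / 2 + ℓ j - o k ∈ T := by
    rwa [show y + 1 / 2 + ℓ j - o k = t + 1 / 2 + ℓ j by linarith]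
  obtain ⟨m, hm⟩ := h.next hy1
  rcases Fin.eq_or_eq_or_eq_of_ne hij hik hjk m with rfl | rfl | rfl
  · rcases (h.disj hm hy2 (by linarith)).lt_or_eq with hlt | heq
    swap
    · exact hne (by linarith)
    obtain ⟨n, hn⟩ := h.next hm
    rcases Fin.eq_or_eq_or_eq_of_ne hij hik hjk n with rfl | rfl | rfl
    · linarith [h.disj hn hy2 hlt]
    · linarith [h.disj hn hy2 hlt]
    · exact hcons _ hn (by linarith) (by linarith)
  · obtain ⟨n, hn⟩ := h.next hm
    rcases Fin.eq_or_eq_or_eq_of_ne hij hik hjk n with rfl | rfl | rfl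
    · linarith [h.disj hn hy2 (by linarith)]
    · linarith [hsep _ hm _ hn (by linarith)]
    · exact hcons _ hn (by linarith) (by linarith)
  · linarith [hsep _ hy1 _ hm (by linarith)]

/-- Between copies of a short letter at distance `1 / 2` lies a copy of the other one. -/
theorem mem_of_half_step (h : IsIntervalTiling o ℓ T) {i j k : Fin 3} (hij : i ≠ j)
    (hik : i ≠ k) (hjk : j ≠ k) (hi : ℓ i = 1 / 2) (hs : ℓ j + ℓ k = 1 / 2)
    {t : ℝ} (ht : t ∈ T) (ht' : t + 1 / 2 ∈ T) : t + o j + ℓ j - o k ∈ T := by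
  have hj := h.pos j
  have hk := h.pos k
  have hy1 : t + o j - o j ∈ T := by rwa [add_sub_cancel_right]
  have hy2 : t + o j + 1 / 2 - o j ∈ T := by rwa [show t + o j + 1 / 2 - o j = t + 1 / 2 by ring]
  obtain ⟨m, hm⟩ := h.next hy1
  rcases Fin.eq_or_eq_or_eq_of_ne hij hik hjk m with rfl | rfl | rfl
  · linarith [h.disj hm hy2 (by linarith)]
  · linarith [h.half_separated hi _ hy1 _ hm (by linarith)]
  · exact hm

/-- The word after a block of the long letter `i`, if it begins with `j` at `x`: the letters `j`
in it are those of one run, with `r'` elements, the letters `k` are those of one run, with `s'`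
elements, and both alternate. The word ends at `y`, with `j` if `τ = 0` and with `k` if `τ = 1`. -/
theorem exists_run_of_end (h : IsIntervalTiling o ℓ T) {i j k : Fin 3} (hij : i ≠ j)
    (hik : i ≠ k) (hjk : j ≠ k) (hi : ℓ i = 1 / 2) (hs : ℓ j + ℓ k = 1 / 2) (hne : ℓ j ≠ ℓ k)
    {ρ x : ℝ} {r : ℕ} (hρ : IsRun T ρ r) (hx : x = ρ + o i + (r : ℝ) / 2) (hxj : x - o j ∈ T) :
    ∃ (r' s' : ℕ) (τ : ℤ) (y : ℝ), IsRun T (x - o j) r' ∧ IsRun T (x + ℓ j - o k) s' ∧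
      (τ = 0 ∨ τ = 1) ∧ (s' : ℝ) + 1 = r' + τ ∧ y = x + ((r' : ℝ) - 1) / 2 + ℓ j + τ * ℓ k ∧
      y - o i ∈ T ∧ y - o i - 1 / 2 ∉ T ∧ ∀ u ∈ T, ρ ≤ u → u < y - o i → u < ρ + (r : ℝ) / 2 := by
  have hj := h.pos j
  have hk := h.pos k
  have hsep := h.half_separated hi
  have hcases := Fin.eq_or_eq_or_eq_of_ne hij hik hjk
  -- the last copy of the long interval before `x`
  obtain ⟨r₀, rfl⟩ := Nat.exists_eq_add_of_le' hρ.pos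
  have hA : x - 1 / 2 - o i ∈ T := by
    have := hρ.mem r₀ (by omega)
    convert this using 1
    rw [hx]; push_cast; ring
  have hnoA : ∀ (m : Fin 3) (z : ℝ), m ≠ i → z < x → x - 1 / 2 ≤ z → z - o m ∉ T :=
    fun m z hm h1 h2 hz => hm (h.eq_of_mem (x := z) hz hA le_rfl (by linarith [h.pos m]) h2
      (by linarith)).2
  obtain ⟨r', hr'⟩ := h.exists_isRun hij hi hxj (by
    rw [show x - o j - 1 / 2 = x - 1 / 2 - o j by ring]
    exact hnoA j _ hij.symm (by linarith) le_rfl)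
  obtain ⟨r₁, hr₁⟩ := Nat.exists_eq_add_of_le' hr'.pos
  have hB : ∀ c : ℕ, c < r' → x + (c : ℝ) / 2 - o j ∈ T := fun c hc => by
    convert hr'.mem c hc using 1; ring
  have hBend : x + (r' : ℝ) / 2 - o j ∉ T := fun hc => hr'.end_notMem (by convert hc using 1; ring)
  have hC : ∀ c : ℕ, c + 1 < r' → x + (c : ℝ) / 2 + ℓ j - o k ∈ T := fun c hc => by
    have := h.mem_of_half_step hij hik hjk hi hs (hr'.mem c (by omega)) (by
      convert hr'.mem (c + 1) hc using 1; push_cast; ring)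
    convert this using 1; ring
  have hlast := hB r₁ (by omega)
  have hrunC : ∀ s' : ℕ, 0 < s' → (∀ c < s', x + (c : ℝ) / 2 + ℓ j - o k ∈ T) →
      x + (s' : ℝ) / 2 + ℓ j - o k ∉ T → IsRun T (x + ℓ j - o k) s' := by
    intro s' hs' h1 h2
    refine ⟨hs', fun hc => ?_, fun c hc => ?_, fun hc => h2 ?_⟩
    · refine hnoA k (x + ℓ j - 1 / 2) hik.symm (by linarith) (by linarith) ?_
      convert hc using 1; ring
    · convert h1 c hc using 1; ring
    · convert hc using 1; ring
  have hbetween : ∀ (s' : ℕ) (τ : ℤ) (y : ℝ), (τ = 0 ∨ τ = 1) → (s' : ℝ) + 1 = r' + τ →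
      y = x + ((r' : ℝ) - 1) / 2 + ℓ j + τ * ℓ k →
      (∀ c < s', x + (c : ℝ) / 2 + ℓ j - o k ∈ T) →
      ∀ u ∈ T, ρ ≤ u → u < y - o i → u < ρ + ((r₀ + 1 : ℕ) : ℝ) / 2 := by
    intro s' τ y hτ hs' hy hCs u hu _ huy
    by_contra hcon
    have h0 : 0 ≤ 2 * (u + o i - x) := by linarith
    have h1 := Nat.floor_le h0
    have h2 := Nat.lt_floor_add_one (2 * (u + o i - x))
    set c := ⌊2 * (u + o i - x)⌋₊ with hc
    have hui : u + o i - o i ∈ T := by rwa [add_sub_cancel_right]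
    have hcr : c < r' := by
      have : (c : ℝ) < r' := by
        rcases hτ with rfl | rfl <;> push_cast at hy <;> linarith
      exact_mod_cast this
    rcases lt_or_ge (u + o i) (x + (c : ℝ) / 2 + ℓ j) with hlt | hge
    · exact hij (h.eq_of_mem (x := u + o i) hui (hB c hcr) le_rfl (by linarith) (by linarith) hlt).2
    · have hcs : c < s' := by
        have hcr' : (c : ℝ) + 1 ≤ r' := by exact_mod_cast hcr
        have : (c : ℝ) < s' := by
          rcases hτ with rfl | rfl <;> push_cast at hy hs'
          · linarith
          · linarith
        exact_mod_cast this
      exact hik (h.eq_of_mem (x := u + o i) hui (hCs c hcs) le_rfl (by linarith) hge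
        (by linarith)).2
  have hr₁R : (r' : ℝ) = r₁ + 1 := by rw [hr₁]; push_cast; ring
  obtain ⟨m, hm⟩ := h.next hlast
  rcases hcases m with rfl | rfl | rfl
  · -- the word ends with the letter it starts with
    have hr2 : 0 < r₁ := by
      rcases Nat.eq_zero_or_pos r₁ with h0 | h0
      · exfalso
        refine h.notMem_of_single hij hik hjk hi hs hne hA ?_
        rw [h0] at hm
        convert hm using 1; push_cast; ring
      · exact h0
    have hCs : ∀ c < r₁, x + (c : ℝ) / 2 + ℓ j - o k ∈ T := fun c hc => hC c (by omega)
    refine ⟨r', r₁, 0, x + (r₁ : ℝ) / 2 + ℓ j, hr', hrunC r₁ hr2 hCs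
      (fun hc => hik (h.inj hm hc)), Or.inl rfl, by rw [hr₁R]; push_cast; ring,
      by rw [hr₁R]; push_cast; ring, hm, fun hc => ?_,
      hbetween r₁ 0 _ (Or.inl rfl) (by rw [hr₁R]; push_cast; ring) (by rw [hr₁R]; push_cast; ring)
        hCs⟩
    have h1 : x + (r₁ : ℝ) / 2 + ℓ j - 1 / 2 - o m ∈ T := by convert hc using 1; ring
    linarith [h.disj h1 hlast (by linarith)]
  · exfalso
    linarith [hsep _ hlast _ hm (by linarith)]
  · have hCs : ∀ c < r', x + (c : ℝ) / 2 + ℓ j - o m ∈ T := fun c hc => by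
      rcases Nat.lt_or_ge (c + 1) r' with h1 | h1
      · exact hC c h1
      · obtain rfl : c = r₁ := by omega
        exact hm
    have hyA : x + (r' : ℝ) / 2 - o i ∈ T := by
      obtain ⟨n, hn⟩ := h.next hm
      have hn' : x + (r' : ℝ) / 2 - o n ∈ T := by
        convert hn using 1; rw [hr₁R]; linarith
      rcases hcases n with rfl | rfl | rfl
      · exact hn'
      · exact absurd hn' hBend
      · exfalso
        linarith [hsep _ hm _ hn (by linarith)]
    refine ⟨r', r', 1, x + (r' : ℝ) / 2, hr', hrunC r' hr'.pos hCs (fun hc => hik ?_),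
      Or.inr rfl, by push_cast; ring, by push_cast; linarith, hyA, fun hc => ?_,
      hbetween r' 1 _ (Or.inr rfl) (by push_cast; ring) (by push_cast; linarith) hCs⟩
    · exact (h.eq_of_mem (x := x + (r' : ℝ) / 2 + ℓ j) hyA hc (by linarith) (by linarith) le_rfl
        (by linarith)).2
    · have h1 : x + (r' : ℝ) / 2 - 1 / 2 - o i ∈ T := by convert hc using 1; ring
      linarith [h.disj h1 hm (by linarith)]

end IsIntervalTiling

/-! ### Tilings with an interval of length one half -/

namespace IsIntervalTiling

variable {o ℓ : Fin 3 → ℝ} {T : Set ℝ}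

/-- The word after a block of the long letter, with either short letter in front; `σ` and `τ` tell
whether it begins, respectively ends, with `k`. -/
theorem exists_runs_after_run (h : IsIntervalTiling o ℓ T) {i j k : Fin 3} (hij : i ≠ j)
    (hik : i ≠ k) (hjk : j ≠ k) (hi : ℓ i = 1 / 2) (hs : ℓ j + ℓ k = 1 / 2) (hne : ℓ j ≠ ℓ k)
    {ρ : ℝ} {r : ℕ} (hρ : IsRun T ρ r) :
    ∃ (a b y : ℝ) (r' s' : ℕ) (σ τ : ℤ), IsRun T a r' ∧ IsRun T b s' ∧ (σ = 0 ∨ σ = 1) ∧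
      (τ = 0 ∨ τ = 1) ∧ y ∈ T ∧ y - 1 / 2 ∉ T ∧
      (∀ u ∈ T, ρ ≤ u → u < y → u < ρ + (r : ℝ) / 2) ∧
      a + o j = ρ + o i + (r : ℝ) / 2 + σ * ℓ k ∧
      b + o k = ρ + o i + (r : ℝ) / 2 + (1 - σ) * ℓ j ∧
      a + o j + ((r' : ℝ) - 1) / 2 + ℓ j = y + o i - τ * ℓ k ∧
      b + o k + ((s' : ℝ) - 1) / 2 + ℓ k = y + o i - (1 - τ) * ℓ j := by
  obtain ⟨x, hx⟩ : ∃ x, x = ρ + o i + (r : ℝ) / 2 := ⟨_, rfl⟩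
  have hA : ρ + o i + ((r - 1 : ℕ) : ℝ) / 2 - o i ∈ T := by
    convert hρ.mem (r - 1) (by have := hρ.pos; omega) using 1; ring
  obtain ⟨m, hm⟩ := h.next hA
  have hm' : x - o m ∈ T := by
    convert hm using 1
    rw [hx, hi, Nat.cast_sub (by have := hρ.pos; omega)]
    push_cast; ring
  rcases Fin.eq_or_eq_or_eq_of_ne hij hik hjk m with rfl | rfl | rfl
  · exact absurd (by convert hm' using 1; rw [hx]; ring) hρ.end_notMem
  · obtain ⟨r', s', τ, y, hr', hs', hτ, hrs, hy, hyT, hyT', hbet⟩ :=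
      h.exists_run_of_end hij hik hjk hi hs hne hρ hx hm'
    refine ⟨_, _, y - o i, r', s', 0, τ, hr', hs', Or.inl rfl, hτ, hyT, hyT', hbet, ?_, ?_, ?_, ?_⟩
    · push_cast; linarith
    · push_cast; linarith
    · linarith
    · have : ((s' : ℝ) + 1) / 2 = (r' + τ) / 2 := by rw [hrs]
      linear_combination this - hy - (τ - 1) * hs
  · obtain ⟨s', r', τ, y, hs', hr', hτ, hrs, hy, hyT, hyT', hbet⟩ :=
      h.exists_run_of_end hik hij hjk.symm hi (by linarith) hne.symm hρ hx hm'
    refine ⟨_, _, y - o i, r', s', 1, 1 - τ, hr', hs', Or.inr rfl, by omega, hyT, hyT', hbet,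
      ?_, ?_, ?_, ?_⟩
    · push_cast; linarith
    · push_cast; linarith
    · have : ((r' : ℝ) + 1) / 2 = (s' + τ) / 2 := by rw [hrs]
      push_cast
      linear_combination this - hy - (τ - 1) * hs
    · push_cast; linarith

theorem exists_enumeration_of_runs (h : IsIntervalTiling o ℓ T) {i j : Fin 3} (hij : i ≠ j)
    (hi : ℓ i = 1 / 2) :
    ∃ ρ : ℤ → ℝ, StrictMono ρ ∧ Set.range ρ = {t ∈ T | t - 1 / 2 ∉ T} := by
  have hsep := h.half_separated hi
  have hlarge : ∀ M : ℝ, ∃ t ∈ T, M < t := by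
    intro M
    obtain ⟨L, hL⟩ := Finite.exists_max fun m => ℓ m + o m
    obtain ⟨m, s, hs, h1, h2⟩ := h.cover (M + (ℓ L + o L))
    exact ⟨_, hs, by linarith [hL m]⟩
  have hsmall : ∀ M : ℝ, ∃ t ∈ T, t < M := by
    intro M
    obtain ⟨L, hL⟩ := Finite.exists_min o
    obtain ⟨m, s, hs, h1, h2⟩ := h.cover (M + o L - 1)
    exact ⟨_, hs, by linarith [hL m]⟩
  refine exists_strictMono_int_range_eq (fun a b => ?_) (fun M => ?_) (fun M => ?_)
  · exact (finite_inter_Icc_of_separated (T := T) (by norm_num : (0 : ℝ) < 1 / 2) hsep a b).subset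
      fun x hx => ⟨hx.1.1, hx.2⟩
  · obtain ⟨t, ht, hMt⟩ := hlarge M
    have hex := h.not_forall_add_half_mem hij hi t
    push Not at hex
    obtain ⟨a, ha⟩ := hex
    obtain ⟨t', ht', hlt⟩ := hlarge (t + (a : ℝ) / 2)
    obtain ⟨ρ, k, hρ, htk, hall⟩ := h.exists_run_start hij hi ht'
    refine ⟨ρ, ⟨by simpa using hall 0 (Nat.zero_le _), hρ⟩, ?_⟩
    by_contra hcon
    have ha0 : (0 : ℝ) ≤ a := a.cast_nonneg
    obtain ⟨c, hc, hct⟩ := eq_add_of_mem_run hsep hall ht (by linarith) (by linarith)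
    apply ha
    have hck : c + a ≤ k := by
      have : ((c + a : ℕ) : ℝ) ≤ k := by push_cast; linarith
      exact_mod_cast this
    convert hall (c + a) hck using 1
    rw [hct]; push_cast; ring
  · obtain ⟨t, ht, hMt⟩ := hsmall M
    obtain ⟨ρ, k, hρ, htk, hall⟩ := h.exists_run_start hij hi ht
    have : (0 : ℝ) ≤ k := k.cast_nonneg
    exact ⟨ρ, ⟨by simpa using hall 0 (Nat.zero_le _), hρ⟩, by linarith⟩

/-- If the letters `j` after the run `n` come from the run `F n`, then `F` is a translation of
`ℤ`: it is increasing, and the letters of the run `F n + 1` have no place between those of `F n`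
and those of `F (n + 1)`. -/
theorem index_shift (h : IsIntervalTiling o ℓ T) {i j k : Fin 3} (hij : i ≠ j)
    (hjk : j ≠ k) (hi : ℓ i = 1 / 2) (hs : ℓ j + ℓ k = 1 / 2)
    {ρ : ℤ → ℝ} (hρ : StrictMono ρ) {r : ℤ → ℕ} (hr : ∀ n, IsRun T (ρ n) (r n))
    (hle : ∀ n, ρ n + (r n : ℝ) / 2 ≤ ρ (n + 1)) {F : ℤ → ℤ} {b σ τ : ℤ → ℝ}
    (hσ : ∀ n, σ n = 0 ∨ σ n = 1) (hτ : ∀ n, τ n = 0 ∨ τ n = 1) (hb : ∀ n, b n ∈ T)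
    (h1 : ∀ n, ρ (F n) + o j = ρ n + o i + (r n : ℝ) / 2 + σ n * ℓ k)
    (h2 : ∀ n, b n + o k = ρ n + o i + (r n : ℝ) / 2 + (1 - σ n) * ℓ j)
    (h3 : ∀ n, ρ (F n) + o j + ((r (F n) : ℝ) - 1) / 2 + ℓ j = ρ (n + 1) + o i - τ n * ℓ k) :
    ∀ n, F n = n + F 0 := by
  have hj := h.pos j
  have hk := h.pos k
  have hτk : ∀ n, 0 ≤ τ n * ℓ k ∧ τ n * ℓ k ≤ ℓ k := fun n => by
    rcases hτ n with h | h <;> rw [h] <;> constructor <;> linarith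
  have hσk : ∀ n, 0 ≤ σ n * ℓ k := fun n => by
    rcases hσ n with h | h <;> rw [h] <;> linarith
  have hr1 : ∀ n, (1 : ℝ) ≤ r n := fun n => by exact_mod_cast (hr n).pos
  have hstep : ∀ n, F (n + 1) = F n + 1 := by
    intro n
    have hlt : F n < F (n + 1) := by
      rw [← hρ.lt_iff_lt]
      linarith [h1 (n + 1), h3 n, hτk n, hσk (n + 1), hr1 (F n), hr1 (n + 1)]
    by_contra hcon
    have hlt2 : ρ (F n + 1) < ρ (F (n + 1)) := hρ (by omega)
    have hz : ρ (F n + 1) + o j - o j ∈ T := by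
      rw [add_sub_cancel_right]; exact (hr _).left_mem
    have hzy : ρ (n + 1) + o i ≤ ρ (F n + 1) + o j := by
      linarith [h3 n, hle (F n), hτk n]
    rcases lt_or_ge (ρ (F n + 1) + o j) (ρ (n + 1) + o i + (r (n + 1) : ℝ) / 2) with hA | hA
    · have h0 : 0 ≤ 2 * (ρ (F n + 1) + o j - (ρ (n + 1) + o i)) := by linarith
      have f1 := Nat.floor_le h0
      have f2 := Nat.lt_floor_add_one (2 * (ρ (F n + 1) + o j - (ρ (n + 1) + o i)))
      set c := ⌊2 * (ρ (F n + 1) + o j - (ρ (n + 1) + o i))⌋₊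
      have hc : c < r (n + 1) := by
        have : (c : ℝ) < r (n + 1) := by linarith
        exact_mod_cast this
      have hcT : ρ (n + 1) + (c : ℝ) / 2 + o i - o i ∈ T := by
        rw [add_sub_cancel_right]; exact (hr (n + 1)).mem c hc
      exact hij (h.eq_of_mem (x := ρ (F n + 1) + o j) hcT hz (by linarith) (by linarith) le_rfl
        (by linarith)).2
    · rcases hσ (n + 1) with h0 | h0
      · have := h1 (n + 1)
        rw [h0] at this
        linarith
      · have e1 := h1 (n + 1)
        have e2 := h2 (n + 1)
        rw [h0] at e1 e2
        have hbT : b (n + 1) + o k - o k ∈ T := by rw [add_sub_cancel_right]; exact hb _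
        exact hjk (h.eq_of_mem (x := ρ (F n + 1) + o j) hz hbT le_rfl (by linarith) (by linarith)
          (by linarith)).2
  intro n
  induction n using Int.induction_on with
  | zero => simp
  | succ n ih => rw [hstep, ih]; ring
  | pred n ih =>
    have := hstep (-n - 1)
    rw [sub_add_cancel, ih] at this
    linarith

/-- Lengths `1 / 2`, `b`, `c` with `b ≠ c`. -/
theorem isSpectralSet_of_half_of_ne (h : IsIntervalTiling o ℓ T)
    (hv : volume (intervalUnion o ℓ) = 1) {i j k : Fin 3} (hij : i ≠ j)
    (hik : i ≠ k) (hjk : j ≠ k) (hi : ℓ i = 1 / 2) (hs : ℓ j + ℓ k = 1 / 2) (hne : ℓ j ≠ ℓ k) :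
    IsSpectralSet (intervalUnion o ℓ) := by
  have hsep := h.half_separated hi
  obtain ⟨ρ, hρ, hrange⟩ := h.exists_enumeration_of_runs hij hi
  have hρmem : ∀ n, ρ n ∈ T ∧ ρ n - 1 / 2 ∉ T := fun n => by
    have : ρ n ∈ Set.range ρ := ⟨n, rfl⟩
    rwa [hrange] at this
  have hidx : ∀ t ∈ T, t - 1 / 2 ∉ T → ∃ n, ρ n = t := fun t ht ht' => by
    have : t ∈ Set.range ρ := by rw [hrange]; exact ⟨ht, ht'⟩
    exact this
  choose r hr using fun n => h.exists_isRun hij hi (hρmem n).1 (hρmem n).2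
  have hrunidx : ∀ t s, IsRun T t s → ∃ n, ρ n = t ∧ r n = s := fun t s ht => by
    obtain ⟨n, rfl⟩ := hidx t ht.left_mem ht.sub_notMem
    exact ⟨n, rfl, (hr n).eq ht⟩
  have hle : ∀ n, ρ n + (r n : ℝ) / 2 ≤ ρ (n + 1) := by
    intro n
    obtain ⟨r₀, hr₀⟩ := Nat.exists_eq_add_of_le' (hr n).pos
    have hlt : ρ n + (r₀ : ℝ) / 2 < ρ (n + 1) := by
      by_contra hcon
      obtain ⟨c, hc, hceq⟩ := eq_add_of_mem_run hsep (fun c hc => (hr n).mem c (by omega))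
        (hρmem (n + 1)).1 (hρ (by omega : n < n + 1)).le (not_lt.1 hcon)
      rcases Nat.eq_zero_or_pos c with h0 | h0
      · have := hρ (by omega : n < n + 1)
        rw [h0] at hceq
        push_cast at hceq
        linarith
      · obtain ⟨c', rfl⟩ := Nat.exists_eq_add_of_le' h0
        apply (hρmem (n + 1)).2
        convert (hr n).mem c' (by omega) using 1
        rw [hceq]; push_cast; ring
    have := hsep _ ((hr n).mem r₀ (by omega)) _ (hρmem (n + 1)).1 hlt
    rw [hr₀]; push_cast; linarith
  have hword := fun n => h.exists_runs_after_run hij hik hjk hi hs hne (hr n)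
  choose a b y r' s' σ τ ha hb hσ hτ hyT hyT' hbet e1 e2 e3 e4 using hword
  have hy : ∀ n, y n = ρ (n + 1) := by
    intro n
    obtain ⟨m, hm⟩ := hidx _ (hyT n) (hyT' n)
    have hlt : n < m := by
      rw [← hρ.lt_iff_lt, hm]
      have h1 : (1 : ℝ) ≤ r' n := by exact_mod_cast (ha n).pos
      have h2 : 0 ≤ (σ n : ℝ) * ℓ k := mul_nonneg
        (by rcases hσ n with h | h <;> rw [h] <;> norm_num) (h.pos k).le
      have h3 : 0 ≤ (τ n : ℝ) * ℓ k := mul_nonneg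
        (by rcases hτ n with h | h <;> rw [h] <;> norm_num) (h.pos k).le
      have h4 : (0 : ℝ) ≤ r n := (r n).cast_nonneg
      linarith [e1 n, e3 n, h.pos j]
    by_contra hcon
    have hlt2 : n + 1 < m := by
      rcases eq_or_ne (n + 1) m with rfl | hne'
      · exact absurd hm.symm hcon
      · omega
    have := hbet n _ (hρmem (n + 1)).1 (hρ (by omega : n < n + 1)).le (by rw [← hm]; exact hρ hlt2)
    linarith [hle n]
  choose F hF1 hF2 using fun n => hrunidx _ _ (ha n)
  choose G hG1 hG2 using fun n => hrunidx _ _ (hb n)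
  simp only [hy, ← hF1, ← hG1, ← hF2, ← hG2] at e1 e2 e3 e4
  have hσR : ∀ n, (σ n : ℝ) = 0 ∨ (σ n : ℝ) = 1 := fun n => by
    rcases hσ n with h | h <;> simp [h]
  have hτR : ∀ n, (τ n : ℝ) = 0 ∨ (τ n : ℝ) = 1 := fun n => by
    rcases hτ n with h | h <;> simp [h]
  have hFs := h.index_shift hij hjk hi hs hρ hr hle (b := fun n => ρ (G n)) hσR hτR
    (fun n => (hρmem _).1) e1 e2 e3
  have hGs := h.index_shift hik hjk.symm hi (by linarith) hρ hr hle (b := fun n => ρ (F n))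
    (σ := fun n => 1 - σ n) (τ := fun n => 1 - τ n)
    (fun n => by rcases hσR n with h | h <;> simp [h])
    (fun n => by rcases hτR n with h | h <;> simp [h])
    (fun n => (hρmem _).1) e2 (fun n => by rw [e1 n]; ring) e4
  obtain ⟨f, hf⟩ : ∃ f, f = F 0 := ⟨_, rfl⟩
  obtain ⟨g, hg⟩ : ∃ g, g = G 0 := ⟨_, rfl⟩
  have hFf : ∀ n, F n = n + f := fun n => by rw [hFs, hf]
  have hGg : ∀ n, G n = n + g := fun n => by rw [hGs, hg]
  simp only [hFf, hGg] at e1 e2 e3 e4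
  have hgrid := run_recurrence_rigid (ρ := ρ) (r := fun n => (r n : ℤ)) (σ := σ) (τ := τ)
    (p := o j - o i) (q := o k - o i) (b := ℓ j) (c := ℓ k) (f := f) (g := g)
    (h.pos j) (h.pos k) hs hne hσ hτ
    (fun n => by push_cast; linarith [e1 n]) (fun n => by push_cast; linarith [e2 n])
    (fun n => by push_cast; linarith [e3 n]) (fun n => by push_cast; linarith [e4 n])
  have hT : ∀ t ∈ T, ∃ n : ℤ, t = ρ 0 + n / 2 := by
    intro t ht
    obtain ⟨s, m, hs', hsm, hall⟩ := h.exists_run_start hij hi ht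
    obtain ⟨n, hn⟩ := hidx s (by simpa using hall 0 (Nat.zero_le _)) hs'
    obtain ⟨N, hN⟩ := hgrid n
    exact ⟨N + m, by rw [hsm, ← hn, hN]; push_cast; ring⟩
  obtain ⟨Nf, hNf⟩ := hgrid (0 + f)
  obtain ⟨Ng, hNg⟩ := hgrid (0 + g)
  have h1 := e1 0
  have h2 := e2 0
  rcases hσR 0 with h0 | h0
  · rw [h0] at h1 h2
    refine h.isSpectralSet_of_half_grid hv hij hik hjk hi hs hT (P := r 0 - Nf) (Q := r 0 - Ng) ?_ ?_
    · push_cast; linarith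
    · push_cast; linarith
  · rw [h0] at h1 h2
    refine h.isSpectralSet_of_half_grid hv hik hij hjk.symm hi (by linarith) hT (P := r 0 - Ng)
      (Q := r 0 - Nf) ?_ ?_
    · push_cast; linarith
    · push_cast; linarith

/-- Case distinction: three equal lengths; no repeated letter; otherwise a repeated letter has
length `1 / 2`, and the two short lengths are equal or different. -/
theorem isSpectralSet (h : IsIntervalTiling o ℓ T) (hlen : ℓ 0 + ℓ 1 + ℓ 2 = 1)
    (hv : volume (intervalUnion o ℓ) = 1) : IsSpectralSet (intervalUnion o ℓ) := by
  by_cases hall : ℓ 0 = ℓ 1 ∧ ℓ 0 = ℓ 2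
  · refine h.isSpectralSet_of_length_eq_third hv fun i => ?_
    fin_cases i
    · show ℓ 0 = 1 / 3
      linarith [hall.1, hall.2]
    · show ℓ 1 = 1 / 3
      linarith [hall.1, hall.2]
    · show ℓ 2 = 1 / 3
      linarith [hall.1, hall.2]
  have hsum : ∀ i j k : Fin 3, i ≠ j → i ≠ k → j ≠ k → ℓ i + ℓ j + ℓ k = 1 := by
    intro i j k hij hik hjk
    fin_cases i <;> fin_cases j <;> fin_cases k <;>
      first | exact absurd rfl hij | exact absurd rfl hik | exact absurd rfl hjk | skip
    all_goals
      simp only [Fin.zero_eta, Fin.mk_one, Fin.reduceFinMk]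
      linarith
  by_cases hrep : ∀ m x, x - o m ∈ T → x + ℓ m - o m ∉ T
  · -- a letter whose length differs from the two others
    have hodd : ∃ i j k : Fin 3, i ≠ j ∧ i ≠ k ∧ j ≠ k ∧ ℓ i ≠ ℓ j ∧ ℓ i ≠ ℓ k := by
      by_cases h01 : ℓ 0 = ℓ 1
      · have h02 : ℓ 0 ≠ ℓ 2 := fun hc => hall ⟨h01, hc⟩
        exact ⟨2, 0, 1, by decide, by decide, by decide, h02.symm, h01 ▸ h02.symm⟩
      · by_cases h02 : ℓ 0 = ℓ 2
        · exact ⟨1, 0, 2, by decide, by decide, by decide, Ne.symm h01, fun hc =>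
            h01 (h02.trans hc.symm)⟩
        · exact ⟨0, 1, 2, by decide, by decide, by decide, h01, h02⟩
    obtain ⟨i, j, k, hij, hik, hjk, hlj, hlk⟩ := hodd
    exact h.isSpectralSet_of_no_repeat hv hrep hij hik hjk (hsum i j k hij hik hjk) hlj hlk
  · push Not at hrep
    obtain ⟨i, x, hx, hx'⟩ := hrep
    obtain ⟨j, k, hij, hik, hjk⟩ : ∃ j k : Fin 3, i ≠ j ∧ i ≠ k ∧ j ≠ k :=
      (by decide : ∀ i : Fin 3, ∃ j k : Fin 3, i ≠ j ∧ i ≠ k ∧ j ≠ k) i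
    have hs := hsum i j k hij hik hjk
    have hhalf : ℓ i = ℓ j + ℓ k := by
      rcases h.length_eq_of_repeat hij hik hjk hx hx' with h1 | h1
      · rcases h.length_eq_of_repeat hik hij hjk.symm hx hx' with h2 | h2
        · exfalso
          refine hall ?_
          have hm : ∀ m, ℓ m = ℓ i := fun m => by
            rcases Fin.eq_or_eq_or_eq_of_ne hij hik hjk m with rfl | rfl | rfl
            · rfl
            · exact h1
            · exact h2
          exact ⟨by rw [hm 0, hm 1], by rw [hm 0, hm 2]⟩
        · linarith
      · exact h1
    by_cases hne : ℓ j = ℓ k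
    · exact h.isSpectralSet_of_length_eq_quarter hv hij hik hjk (by linarith) (by linarith)
        (by linarith)
    · exact h.isSpectralSet_of_half_of_ne hv hij hik hjk (by linarith) (by linarith) hne

end IsIntervalTiling

theorem theorem2p1 (A B C : Set ℝ)
    (hA : A.OrdConnected) (hB : B.OrdConnected) (hC : C.OrdConnected)
    (hA0 : 0 < volume A) (hB0 : 0 < volume B) (hC0 : 0 < volume C)
    (hAB : Disjoint A B) (hAC : Disjoint A C) (hBC : Disjoint B C)
    (hlen : volume A + volume B + volume C = 1)
    (htile : TilesByTranslations (A ∪ B ∪ C)) :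
    IsSpectralSet (A ∪ B ∪ C) := by
  obtain ⟨o, ℓ, T, h, hsum, hv, hae⟩ :=
    exists_isIntervalTiling hA hB hC hA0 hB0 hC0 hAB hAC hBC hlen htile
  exact (h.isSpectralSet hsum hv).congr_ae hae
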